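/- Let $\rho$ denote the Dickman–de Bruijn function, i.e. the continuous function on $[0,\infty)$ with $\rho(u)=1$ for $0\le u\le 1$ and $u\rho'(u)=-\rho(u-1)$ for $u>1$. For $\eta>1$ let $s(\eta)$ be the unique $s>0$ with $(e^{s}-1)/s=\eta$. Put $\mathcal X(u)=\frac{\log\log u}{\log u}$ and $\mathcal Y(u)=\frac1{\log u}$. For $\mathbf F\in\mathbb R[[X,Y]]$ and $n\ge 0$ let $\mathbf F^{(n)}$ be the truncation of $\mathbf F$ to total degree at most $n$; $\mathbf F$ is said to be associated to a real function $f$ defined near $+\infty$ if for every integer $n\ge0$, $f(u)=\mathbf F^{(n)}(\mathcal X(u),\mathcal Y(u))+o(\mathcal Y(u)^n)$ as $u\to\infty$. Let $S(i,k)$ be the signed Stirling numbers of the first kind, let $$\mathbf P=1+X+Y\sum_{i\ge1}\sum_{j=1}^{i}\frac{S(i,i-j+1)}{j!}X^jY^{i-j}\in\mathbb R[[X,Y]],$$ let $\Delta$ be the $\mathbb R$-linear derivation of $\mathbb R[[X,Y]]$ given by $\Delta F = Y(Y-X)\,\partial F/\partial X-Y^2\,\partial F/\partial Y$ (it raises degrees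 by at least one, so $(1+\Delta)^{-1}=\sum_{k\ge0}(-1)^k\Delta^k$ makes sense; moreover every $\Delta F$ is divisible by $Y$), and let $$\mathbf Q=(1-Y)\mathbf P+Y(1+\Delta)^{-1}(1-Y^{-1})\Delta\mathbf P .$$ Then $\mathbf Q$ is associated to the function $u\mapsto\frac1{u\log u}\int_e^u s(\eta)\,\mathrm d\eta$, and for every integer $n\ge 0$, as $u\to+\infty$, $$\rho(u)=\exp\Bigl(-u\log u\,\bigl(\mathbf Q^{(n)}(\mathcal X(u),\mathcal Y(u))+o(\mathcal Y(u)^n)\bigr)\Bigr).$$ -/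

import Mathlib

open Filter Topology

namespace DickmanExpansion

noncomputable section

/-! ### The Dickman-de Bruijn function -/

/-- One step of the iteration solving `ρ(u) = 1` for `u ≤ 1` and
`ρ(u) = 1 - ∫_1^u ρ(t - 1) / t dt` for `u ≥ 1`. -/
def rhoStep (f : ℝ → ℝ) (u : ℝ) : ℝ :=
  if u ≤ 1 then 1 else 1 - ∫ t in (1 : ℝ)..u, f (t - 1) / t

/-- `rhoIter n` agrees with the Dickman-de Bruijn function on `[0, n + 1]`. -/
def rhoIter (n : ℕ) : ℝ → ℝ := rhoStep^[n] (fun _ => 1)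

/-- The Dickman-de Bruijn function `ρ` on `[0, ∞)` (method of steps): the continuous function with
`ρ = 1` on `[0, 1]` and `u ρ'(u) = -ρ(u - 1)` for `u > 1`. See `rho_eq_one`, `continuous_rho`,
`hasDerivAt_rho`, `rho_unique`. (Its values at negative arguments play no role.) -/
def rho (u : ℝ) : ℝ := rhoIter ⌈u⌉₊ u

theorem rhoIter_succ (n : ℕ) : rhoIter (n + 1) = rhoStep (rhoIter n) := by
  simp only [rhoIter, Function.iterate_succ_apply']

theorem rhoIter_eq_one (n : ℕ) {u : ℝ} (hu : u ≤ 1) : rhoIter n u = 1 := by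
  cases n with
  | zero => rfl
  | succ n => rw [rhoIter_succ]; simp [rhoStep, hu]

theorem rhoIter_eq_succ (n : ℕ) : ∀ u : ℝ, u ≤ n + 1 → rhoIter n u = rhoIter (n + 1) u := by
  induction n with
  | zero =>
    intro u hu
    have hu1 : u ≤ 1 := by simpa using hu
    rw [rhoIter_eq_one _ hu1, rhoIter_eq_one _ hu1]
  | succ n ih =>
    intro u hu
    by_cases h1 : u ≤ 1
    · rw [rhoIter_eq_one _ h1, rhoIter_eq_one _ h1]
    · rw [rhoIter_succ n, rhoIter_succ (n + 1)]
      simp only [rhoStep, h1, if_false]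
      congr 1
      apply intervalIntegral.integral_congr
      intro t ht
      rw [Set.uIcc_of_le (by linarith)] at ht
      have h2 : t - 1 ≤ n + 1 := by
        have := ht.2
        push_cast at hu
        linarith
      simp only [ih (t - 1) h2]

theorem rhoIter_eq_of_le {n m : ℕ} (hnm : n ≤ m) {u : ℝ} (hu : u ≤ n + 1) :
    rhoIter n u = rhoIter m u := by
  induction m, hnm using Nat.le_induction with
  | base => rfl
  | succ m hm ih =>
    rw [ih]
    apply rhoIter_eq_succ
    have : (n : ℝ) ≤ m := by exact_mod_cast hm
    linarith

theorem rho_eq_rhoIter (n : ℕ) {u : ℝ} (hu : u ≤ n + 1) : rho u = rhoIter n u := by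
  have h1 : u ≤ (⌈u⌉₊ : ℝ) + 1 := (Nat.le_ceil u).trans (by linarith)
  rcases le_total n ⌈u⌉₊ with h | h
  · exact (rhoIter_eq_of_le h hu).symm
  · exact rhoIter_eq_of_le h h1

theorem rho_eq_one {u : ℝ} (hu : u ≤ 1) : rho u = 1 := rhoIter_eq_one _ hu

theorem continuous_rhoStep {f : ℝ → ℝ} (hf : Continuous f) : Continuous (rhoStep f) := by
  have hg : Continuous fun t : ℝ => f (t - 1) / max t 1 := by
    refine (hf.comp (continuous_id.sub continuous_const)).div₀
      (continuous_id.max continuous_const) fun t => ?_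
    have := le_max_right t (1 : ℝ)
    positivity
  have hG : Continuous fun u : ℝ => 1 - ∫ t in (1 : ℝ)..u, f (t - 1) / max t 1 :=
    continuous_const.sub
      (intervalIntegral.continuous_primitive (fun a b => hg.intervalIntegrable a b) 1)
  have hh : rhoStep f = fun u : ℝ =>
      if u ≤ 1 then (1 : ℝ) else 1 - ∫ t in (1 : ℝ)..u, f (t - 1) / max t 1 := by
    funext u
    by_cases h : u ≤ 1
    · simp [rhoStep, h]
    · simp only [rhoStep, h, if_false]
      congr 1
      apply intervalIntegral.integral_congr
      intro t ht
      rw [Set.uIcc_of_le (by linarith)] at ht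
      simp only [max_eq_left ht.1]
  rw [hh]
  refine continuous_const.if_le hG continuous_id continuous_const ?_
  rintro x rfl
  simp

theorem continuous_rhoIter (n : ℕ) : Continuous (rhoIter n) := by
  induction n with
  | zero => exact continuous_const
  | succ n ih => rw [rhoIter_succ]; exact continuous_rhoStep ih

theorem continuous_rho : Continuous rho := by
  rw [continuous_iff_continuousAt]
  intro u
  obtain ⟨n, hn⟩ := exists_nat_gt u
  refine (continuous_rhoIter n).continuousAt.congr ?_
  filter_upwards [Iio_mem_nhds hn] with v hv
  refine (rho_eq_rhoIter n ?_).symm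
  have : v < n := hv
  linarith

theorem rho_eq_integral {u : ℝ} (hu : 1 ≤ u) :
    rho u = 1 - ∫ t in (1 : ℝ)..u, rho (t - 1) / t := by
  obtain ⟨n, hn⟩ := exists_nat_gt u
  have h1 : rho u = rhoStep (rhoIter n) u := by
    rw [← rhoIter_succ]
    exact rho_eq_rhoIter _ (by push_cast; linarith)
  rcases hu.eq_or_lt with rfl | h
  · simp [rho_eq_one]
  · rw [h1]
    simp only [rhoStep, not_le.mpr h, if_false]
    congr 1
    apply intervalIntegral.integral_congr
    intro t ht
    rw [Set.uIcc_of_le hu] at ht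
    have h2 := ht.2
    simp only
    rw [rho_eq_rhoIter n (by linarith)]

/-- The delay differential equation `u ρ'(u) = -ρ(u - 1)` for `u > 1`. -/
theorem hasDerivAt_rho {u : ℝ} (hu : 1 < u) : HasDerivAt rho (-rho (u - 1) / u) u := by
  have hc : ContinuousOn (fun t : ℝ => rho (t - 1) / t) (Set.Ioi 0) :=
    ((continuous_rho.comp (continuous_id.sub continuous_const)).continuousOn).div
      continuousOn_id fun t ht => ne_of_gt ht
  have hint : IntervalIntegrable (fun t : ℝ => rho (t - 1) / t) MeasureTheory.volume 1 u := by
    apply (hc.mono ?_).intervalIntegrable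
    intro t ht
    rw [Set.uIcc_of_le hu.le] at ht
    exact lt_of_lt_of_le one_pos ht.1
  have hd := intervalIntegral.integral_hasDerivAt_right hint
    (hc.stronglyMeasurableAtFilter isOpen_Ioi u (by simpa using one_pos.trans hu))
    (hc.continuousAt (Ioi_mem_nhds (one_pos.trans hu)))
  have h2 := hd.const_sub 1
  rw [neg_div]
  refine h2.congr_of_eventuallyEq ?_
  filter_upwards [Ioi_mem_nhds hu] with v hv
  exact rho_eq_integral (le_of_lt hv)

/-- `ρ` is determined on `[0, ∞)` by its initial values and its delay differential equation. -/
theorem rho_unique {f : ℝ → ℝ} (hf : ContinuousOn f (Set.Ici 0))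
    (h1 : ∀ u ∈ Set.Icc (0 : ℝ) 1, f u = 1)
    (hd : ∀ u > 1, HasDerivAt f (-f (u - 1) / u) u) : ∀ u ≥ 0, f u = rho u := by
  have key : ∀ n : ℕ, ∀ u : ℝ, 0 ≤ u → u ≤ n + 1 → f u = rho u := by
    intro n
    induction n with
    | zero =>
      intro u h0 hu
      have hu1 : u ≤ 1 := by simpa using hu
      rw [h1 u ⟨h0, hu1⟩, rho_eq_one hu1]
    | succ n ih =>
      intro u h0 hu
      push_cast at hu
      rcases le_or_gt u 1 with hu1 | hu1
      · rw [h1 u ⟨h0, hu1⟩, rho_eq_one hu1]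
      · have hc : ContinuousOn (fun v => f v - rho v) (Set.Icc 1 u) :=
          (hf.mono fun v hv => Set.mem_Ici.mpr (zero_le_one.trans hv.1)).sub
            continuous_rho.continuousOn
        have h3 := constant_of_has_deriv_right_zero hc (fun v hv => ?_) u ⟨hu1.le, le_rfl⟩
        · have h4 : f u - rho u = f 1 - rho 1 := h3
          rw [h1 1 ⟨zero_le_one, le_rfl⟩, rho_eq_one le_rfl] at h4
          linarith
        · rcases hv.1.eq_or_lt with rfl | hv1
          · have hz : HasDerivWithinAt (fun v => f v - rho v) 0 (Set.Ici (1 : ℝ)) 1 := by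
              have hcont : ContinuousOn (fun v => f v - rho v) (Set.Ico 1 u) :=
                hc.mono Set.Ico_subset_Icc_self
              refine hasDerivWithinAt_Ici_of_tendsto_deriv (s := Set.Ioo 1 u) ?_ ?_ ?_ ?_
              · intro x hx
                exact ((hd x hx.1).sub (hasDerivAt_rho hx.1)).differentiableAt.differentiableWithinAt
              · exact (hc 1 ⟨le_rfl, hu1.le⟩).mono Set.Ioo_subset_Icc_self
              · exact Ioo_mem_nhdsGT hu1
              · refine tendsto_const_nhds.congr' ?_
                filter_upwards [Ioo_mem_nhdsGT hu1] with x hx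
                have h5 := ((hd x hx.1).sub (hasDerivAt_rho hx.1)).deriv
                have h6 := ih (x - 1) (by linarith [hx.1]) (by linarith [hx.2])
                rw [h6, sub_self] at h5
                exact h5.symm
            exact hz
          · have h5 := (hd v hv1).sub (hasDerivAt_rho hv1)
            have h6 := ih (v - 1) (by linarith) (by linarith [hv.2])
            rw [h6, sub_self] at h5
            exact h5.hasDerivWithinAt
  intro u hu
  obtain ⟨n, hn⟩ := exists_nat_gt u
  exact key n u hu (by linarith)

/-! ### The function `s`, inverse of `s ↦ (e^s - 1) / s` -/

/-- The function `φ(s) = (e^s - 1) / s`. -/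
def phi (s : ℝ) : ℝ := (Real.exp s - 1) / s

/-- For `η > 1`, `sFun η` is the unique `s > 0` with `(e^s - 1) / s = η`. -/
def sFun (η : ℝ) : ℝ := Function.invFunOn phi (Set.Ioi 0) η

theorem strictMonoOn_phi : StrictMonoOn phi (Set.Ioi 0) := by
  intro x hx y hy hxy
  have hx0 : (0 : ℝ) < x := hx
  have h := strictConvexOn_exp.secant_strict_mono (a := 0) (x := x) (y := y)
    (Set.mem_univ _) (Set.mem_univ _) (Set.mem_univ _) hx0.ne' (ne_of_gt hy) hxy
  simpa [phi] using h

theorem exists_phi_eq {η : ℝ} (hη : 1 < η) : ∃ s ∈ Set.Ioi (0 : ℝ), phi s = η := by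
  have h0 : Tendsto phi (𝓝[>] 0) (𝓝 1) := by
    have h := (Real.hasDerivAt_exp 0).tendsto_slope
    rw [Real.exp_zero] at h
    refine (h.mono_left (nhdsWithin_mono _ fun x hx => ne_of_gt hx)).congr fun x => ?_
    simp [slope_def_field, phi]
  obtain ⟨a, ha, ha0⟩ := ((h0.eventually (gt_mem_nhds hη)).and self_mem_nhdsWithin).exists
  have hb : η ≤ phi (2 * η) := by
    rw [phi, le_div_iff₀ (by linarith)]
    have := Real.quadratic_le_exp_of_nonneg (x := 2 * η) (by linarith)
    nlinarith
  have ha0' : (0 : ℝ) < a := ha0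
  have hab : a ≤ 2 * η := by
    by_contra! hlt
    have := strictMonoOn_phi (Set.mem_Ioi.mpr (by linarith : (0 : ℝ) < 2 * η)) ha0 hlt
    linarith
  have hc : ContinuousOn phi (Set.Icc a (2 * η)) := by
    refine (Real.continuous_exp.sub continuous_const).continuousOn.div continuousOn_id ?_
    intro t ht
    exact ne_of_gt (lt_of_lt_of_le ha0' ht.1)
  obtain ⟨s, hs, hse⟩ := intermediate_value_Icc hab hc ⟨ha.le, hb⟩
  exact ⟨s, lt_of_lt_of_le ha0' hs.1, hse⟩

theorem sFun_pos {η : ℝ} (hη : 1 < η) : 0 < sFun η :=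
  Function.invFunOn_mem (exists_phi_eq hη)

theorem phi_sFun {η : ℝ} (hη : 1 < η) : phi (sFun η) = η :=
  Function.invFunOn_eq (exists_phi_eq hη)

theorem eq_sFun {η s : ℝ} (hη : 1 < η) (hs : 0 < s) (h : phi s = η) : s = sFun η :=
  strictMonoOn_phi.injOn hs (sFun_pos hη) (h.trans (phi_sFun hη).symm)

/-- `s` is increasing, so that it is integrable on every compact interval of `(1, ∞)`. -/
theorem monotoneOn_sFun : MonotoneOn sFun (Set.Ioi 1) := by
  intro x hx y hy hxy
  rw [← strictMonoOn_phi.le_iff_le (sFun_pos hx) (sFun_pos hy), phi_sFun hx, phi_sFun hy]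
  exact hxy

/-! ### Asymptotic expansions in `log log u / log u` and `1 / log u` -/

/-- `𝒳(u) = log log u / log u`. -/
def calX (u : ℝ) : ℝ := Real.log (Real.log u) / Real.log u

/-- `𝒴(u) = 1 / log u`. -/
def calY (u : ℝ) : ℝ := 1 / Real.log u

/-- Formal power series in the variables `X` (index `0`) and `Y` (index `1`). -/
abbrev Series := MvPowerSeries (Fin 2) ℝ

/-- The variable `X`. -/
def varX : Series := MvPowerSeries.X 0

/-- The variable `Y`. -/
def varY : Series := MvPowerSeries.X 1

/-- The value at `(x, y)` of the truncation `F^(n)` of `F` to total degree at most `n`. -/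
def truncEval (F : Series) (n : ℕ) (x y : ℝ) : ℝ :=
  MvPolynomial.eval ![x, y] (MvPowerSeries.truncTotal (n + 1) F)

/-- `F` is the series associated to `f`: for all `n`,
`f(u) = F^(n)(𝒳(u), 𝒴(u)) + o(𝒴(u)^n)` as `u → ∞`. -/
def IsAssociatedSeries (f : ℝ → ℝ) (F : Series) : Prop :=
  ∀ n : ℕ, (fun u => f u - truncEval F n (calX u) (calY u)) =o[atTop] fun u => calY u ^ n

/-! ### The explicit series -/

/-- Signed Stirling numbers of the first kind. -/
def signedStirlingFirst (n k : ℕ) : ℤ := (-1) ^ (n + k) * (Nat.stirlingFirst n k : ℤ)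

/-- The series `∑_{i ≥ 1} ∑_{1 ≤ j ≤ i} S(i, i - j + 1) / j! X^j Y^(i - j)`, where `S` denotes the
signed Stirling numbers of the first kind: the coefficient of `X^j Y^l` is `S(j + l, l + 1) / j!`
if `j ≥ 1`, and `0` if `j = 0`. -/
def stirlingSeries : Series := fun m =>
  if m 0 = 0 then 0
  else (signedStirlingFirst (m 0 + m 1) (m 1 + 1) : ℝ) / (Nat.factorial (m 0) : ℝ)

/-- The series `P` associated to `s(η) / log η`. -/
def PSeries : Series := 1 + varX + varY * stirlingSeries

/-- The derivation `Δ` with `Δ X = Y (Y - X)` and `Δ Y = -Y²`. -/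
def Delta (F : Series) : Series :=
  varY * (varY - varX) * MvPowerSeries.pderiv ℝ 0 F - varY ^ 2 * MvPowerSeries.pderiv ℝ 1 F

/-- Division by `Y` of a series divisible by `Y` (every series `Δ F` is so). -/
def divY (F : Series) : Series := fun m => MvPowerSeries.coeff (m + Finsupp.single 1 1) F

/-- `(1 + Δ)⁻¹ F = ∑_k (-1)^k Δ^k F`. As `Δ` raises the degree by at least one, only the terms with
`k ≤ d` contribute to the coefficients of degree `d`. -/
def invOneAddDelta (F : Series) : Series := fun m =>
  ∑ k ∈ Finset.range (m.degree + 1), (-1 : ℝ) ^ k * MvPowerSeries.coeff m (Delta^[k] F)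

/-- The series `Q = (1 - Y) P + Y (1 + Δ)⁻¹ (1 - Y⁻¹) Δ P`. -/
def QSeries : Series :=
  (1 - varY) * PSeries + varY * invOneAddDelta (Delta PSeries - divY (Delta PSeries))

theorem Delta_varX : Delta varX = varY * (varY - varX) := by
  simp [Delta, varX]

theorem Delta_varY : Delta varY = -varY ^ 2 := by
  simp [Delta, varY]

theorem varY_mul_divY_Delta (F : Series) : varY * divY (Delta F) = Delta F := by
  have hY : (varY : Series) = MvPowerSeries.monomial (Finsupp.single 1 1) 1 := rfl
  have key : ∀ G : Series, divY (varY * G) = G := by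
    intro G
    ext m
    change MvPowerSeries.coeff (m + Finsupp.single 1 1) (varY * G) = _
    rw [hY, add_comm, MvPowerSeries.coeff_add_monomial_mul, one_mul]
  obtain ⟨G, hG⟩ : ∃ G : Series, Delta F = varY * G :=
    ⟨(varY - varX) * MvPowerSeries.pderiv ℝ 0 F - varY * MvPowerSeries.pderiv ℝ 1 F, by
      rw [Delta]; ring⟩
  rw [hG, key]

theorem Delta_add (F G : Series) : Delta (F + G) = Delta F + Delta G := by
  simp only [Delta, map_add]
  ring

theorem Delta_smul (c : ℝ) (F : Series) : Delta (c • F) = c • Delta F := by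
  simp only [Delta, Derivation.map_smul, smul_sub, mul_smul_comm]

theorem order_Delta {F : Series} {d : ℕ} (h : (d : ℕ∞) ≤ F.order) :
    ((d + 1 : ℕ) : ℕ∞) ≤ (Delta F).order := by
  have hp : ∀ i : Fin 2, ((d - 1 : ℕ) : ℕ∞) ≤ (MvPowerSeries.pderiv ℝ i F).order := by
    intro i
    refine MvPowerSeries.nat_le_order fun m hm => ?_
    rw [MvPowerSeries.coeff_pderiv, MvPowerSeries.coeff_of_lt_order, zero_mul]
    refine lt_of_lt_of_le ?_ h
    rw [map_add, Finsupp.degree_single]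
    exact_mod_cast (by omega : m.degree + 1 < d)
  have hX : ∀ i : Fin 2, (1 : ℕ∞) ≤ (MvPowerSeries.X i : Series).order := by
    intro i
    rw [MvPowerSeries.X, MvPowerSeries.order_monomial_of_ne_zero one_ne_zero,
      Finsupp.degree_single]
    rfl
  have hsub : ∀ {A B : Series} {k : ℕ∞}, k ≤ A.order → k ≤ B.order → k ≤ (A - B).order := by
    intro A B k hA hB
    refine MvPowerSeries.le_order fun m hm => ?_
    rw [map_sub, MvPowerSeries.coeff_of_lt_order (hm.trans_le hA),
      MvPowerSeries.coeff_of_lt_order (hm.trans_le hB), sub_zero]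
  have hmul : ∀ {A B : Series} {k l : ℕ∞}, k ≤ A.order → l ≤ B.order → k + l ≤ (A * B).order :=
    fun hA hB => (add_le_add hA hB).trans MvPowerSeries.le_order_mul
  have hle : ((d + 1 : ℕ) : ℕ∞) ≤ 1 + 1 + ((d - 1 : ℕ) : ℕ∞) := by
    exact_mod_cast (by omega : d + 1 ≤ 1 + 1 + (d - 1))
  refine hle.trans (hsub (hmul (hmul (hX 1) (hsub (hX 1) (hX 0))) (hp 0)) ?_)
  rw [pow_two]
  exact hmul (hmul (hX 1) (hX 1)) (hp 1)

theorem order_Delta_iterate (F : Series) (k : ℕ) : (k : ℕ∞) ≤ (Delta^[k] F).order := by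
  induction k with
  | zero => simp
  | succ k ih => rw [Function.iterate_succ_apply']; exact order_Delta ih

/-- `invOneAddDelta` is the inverse of the operator `1 + Δ`. -/
theorem invOneAddDelta_spec (F : Series) : invOneAddDelta F + Delta (invOneAddDelta F) = F := by
  let S : ℕ → Series := fun N => ∑ k ∈ Finset.range N, (-1 : ℝ) ^ k • Delta^[k] F
  have hS : ∀ N, S N + Delta (S N) = F - (-1 : ℝ) ^ N • Delta^[N] F := by
    intro N
    induction N with
    | zero => simp [S, Delta]
    | succ N ih =>
      have h1 : S (N + 1) = S N + (-1 : ℝ) ^ N • Delta^[N] F := Finset.sum_range_succ _ _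
      rw [h1, Delta_add, Delta_smul, ← Function.iterate_succ_apply' Delta, pow_succ]
      linear_combination (exp := 1) ih + (by module :
        (-1 : ℝ) ^ N • Delta^[N + 1] F + ((-1 : ℝ) ^ N * -1) • Delta^[N + 1] F = 0)
  have hI : ∀ N : ℕ, (N : ℕ∞) ≤ (invOneAddDelta F - S N).order := by
    intro N
    refine MvPowerSeries.nat_le_order fun m hm => ?_
    rw [map_sub, sub_eq_zero]
    change ∑ k ∈ Finset.range (m.degree + 1), (-1 : ℝ) ^ k * MvPowerSeries.coeff m (Delta^[k] F) = _
    simp only [S, map_sum, map_smul, smul_eq_mul]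
    refine Finset.sum_subset (Finset.range_subset_range.mpr hm) fun k _ hk => ?_
    rw [Finset.mem_range, not_lt] at hk
    rw [MvPowerSeries.coeff_of_lt_order, mul_zero]
    exact lt_of_lt_of_le (by exact_mod_cast hk) (order_Delta_iterate F k)
  ext m
  have h1 := hI (m.degree + 1)
  have h2 := order_Delta h1
  have hlt : (m.degree : ℕ∞) < ((m.degree + 1 : ℕ) : ℕ∞) := by exact_mod_cast Nat.lt_succ_self _
  have hlt2 : (m.degree : ℕ∞) < ((m.degree + 1 + 1 : ℕ) : ℕ∞) := by
    exact_mod_cast (by omega : m.degree < m.degree + 1 + 1)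
  have e1 := MvPowerSeries.coeff_of_lt_order (hlt.trans_le h1)
  have e2 := MvPowerSeries.coeff_of_lt_order (hlt2.trans_le h2)
  have e3 := MvPowerSeries.coeff_of_lt_order
    (hlt.trans_le (order_Delta_iterate F (m.degree + 1)))
  have e4 := congrArg (MvPowerSeries.coeff m) (hS (m.degree + 1))
  have e5 : Delta (invOneAddDelta F) =
      Delta (invOneAddDelta F - S (m.degree + 1)) + Delta (S (m.degree + 1)) := by
    rw [← Delta_add, sub_add_cancel]
  rw [map_add, map_sub, map_smul, e3, smul_zero, sub_zero] at e4
  rw [map_sub, sub_eq_zero] at e1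
  rw [map_add, e5, map_add, e2, zero_add, e1, e4]

end

end DickmanExpansion

/-! Taking logarithms in `e^s = 1 + s η` gives `s = log η + log s + δ` with `0 ≤ δ ≤ 1 / η`. For `p
= s / log η` this reads `p = 1 + 𝒳 + 𝒴 log p + 𝒴 δ`, so the series of `p` should solve `P = 1 + X +
Y log P`; that is, the Stirling series `σ` should be `log P`. No formal logarithm is used: the
Stirling recurrence is a linear transport equation for `σ`, which forces the Burgers equation `∂σ/∂Y
= σ ∂σ/∂X`, and the two together give `P ∂σ = ∂P` in both variables. Integrating along rays, `exp
(-σ) P = 1` up to high order for the truncations, and a contraction estimate then compares `p` with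
the truncations of `P` (`sFun_div_log_isBigO`).

Along `(𝒳, 𝒴)` the operator `u d/du` acts as `Δ`, so the derivative of `u log u Q(𝒳, 𝒴)` is `log u`
times `(1 + Y + Δ) Q`. The formula for `Q` is the one that makes `(1 + Y + Δ) Q = P`
(`QSeries_transport`), hence `u log u Q` expands the integral of `s`
(`integral_sFun_sub_isLittleO`).

Finally `ρ` satisfies `∫_{u-1}^u ρ = u ρ(u)`. As `s` increases and `(e^s - 1) / s = u`, the function
`E(u) = exp (-∫_e^u s)` is a supersolution of this equation and `E(u + 1)` a subsolution. Comparison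
bounds `ρ(u)` between constant multiples of `E(u + 1)` and `E(u)`, so `log ρ(u) = -∫_e^u s + O(log
u)`; divided by `u log u`, the error is `O(1 / u)`, smaller than every power of `𝒴`. -/

namespace DickmanExpansion

noncomputable section

/-! ### Coefficients of formal power series in two variables -/

/-- The exponent of the monomial `X^j Y^l`. -/
def expo (j l : ℕ) : Fin 2 →₀ ℕ := Finsupp.single 0 j + Finsupp.single 1 l

@[simp] theorem expo_zero (j l : ℕ) : expo j l 0 = j := by simp [expo]

@[simp] theorem expo_one (j l : ℕ) : expo j l 1 = l := by simp [expo]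

theorem expo_add_single_zero (j l : ℕ) : expo j l + Finsupp.single 0 1 = expo (j + 1) l := by
  ext i; fin_cases i <;> simp [expo]

theorem expo_add_single_one (j l : ℕ) : expo j l + Finsupp.single 1 1 = expo j (l + 1) := by
  ext i; fin_cases i <;> simp [expo]

theorem eq_expo (m : Fin 2 →₀ ℕ) : m = expo (m 0) (m 1) := by
  ext i; fin_cases i <;> simp [expo]

theorem series_ext {F G : Series}
    (h : ∀ j l, MvPowerSeries.coeff (expo j l) F = MvPowerSeries.coeff (expo j l) G) : F = G := by
  ext m
  rw [eq_expo m]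
  exact h _ _

theorem coeff_X_mul_add_single (i : Fin 2) (m : Fin 2 →₀ ℕ) (G : Series) :
    MvPowerSeries.coeff (m + Finsupp.single i 1) (MvPowerSeries.X i * G) =
      MvPowerSeries.coeff m G := by
  rw [MvPowerSeries.X, add_comm, MvPowerSeries.coeff_add_monomial_mul, one_mul]

theorem coeff_X_mul_eq_zero (i : Fin 2) {m : Fin 2 →₀ ℕ} (hm : m i = 0) (G : Series) :
    MvPowerSeries.coeff m (MvPowerSeries.X i * G) = 0 := by
  classical
  rw [MvPowerSeries.X, MvPowerSeries.coeff_monomial_mul, if_neg]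
  intro h
  have := h i
  simp [hm] at this

theorem coeff_X_mul_pderiv (i : Fin 2) (m : Fin 2 →₀ ℕ) (F : Series) :
    MvPowerSeries.coeff m (MvPowerSeries.X i * MvPowerSeries.pderiv ℝ i F) =
      m i * MvPowerSeries.coeff m F := by
  by_cases hm : m i = 0
  · rw [coeff_X_mul_eq_zero i hm, hm]; simp
  · obtain ⟨n, rfl⟩ : ∃ n, m = n + Finsupp.single i 1 :=
      ⟨m - Finsupp.single i 1, (tsub_add_cancel_of_le (by
        rw [Finsupp.single_le_iff]; omega)).symm⟩
    rw [coeff_X_mul_add_single, MvPowerSeries.coeff_pderiv]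
    simp
    ring

theorem coeff_varY_mul_succ (j l : ℕ) (G : Series) :
    MvPowerSeries.coeff (expo j (l + 1)) (varY * G) = MvPowerSeries.coeff (expo j l) G := by
  rw [← expo_add_single_one, varY, coeff_X_mul_add_single]

theorem coeff_varY_mul_zero (j : ℕ) (G : Series) :
    MvPowerSeries.coeff (expo j 0) (varY * G) = 0 :=
  coeff_X_mul_eq_zero 1 (by simp) G

theorem coeff_varX_mul_zero (l : ℕ) (G : Series) :
    MvPowerSeries.coeff (expo 0 l) (varX * G) = 0 :=
  coeff_X_mul_eq_zero 0 (by simp) G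

theorem coeff_pderiv_zero (j l : ℕ) (F : Series) :
    MvPowerSeries.coeff (expo j l) (MvPowerSeries.pderiv ℝ 0 F) =
      (j + 1) * MvPowerSeries.coeff (expo (j + 1) l) F := by
  rw [MvPowerSeries.coeff_pderiv, expo_add_single_zero, expo_zero, mul_comm]

/-- The coefficients of `(1 + X - Y) ∂F/∂X + Y ∂F/∂Y`. -/
theorem coeff_transport (F : Series) (j l : ℕ) :
    MvPowerSeries.coeff (expo j l) ((1 + varX - varY) * MvPowerSeries.pderiv ℝ 0 F +
        varY * MvPowerSeries.pderiv ℝ 1 F) =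
      (j + 1) * MvPowerSeries.coeff (expo (j + 1) l) F +
        (j + l) * MvPowerSeries.coeff (expo j l) F -
        MvPowerSeries.coeff (expo j l) (varY * MvPowerSeries.pderiv ℝ 0 F) := by
  have e : (1 + varX - varY) * MvPowerSeries.pderiv ℝ 0 F + varY * MvPowerSeries.pderiv ℝ 1 F =
      MvPowerSeries.pderiv ℝ 0 F + varX * MvPowerSeries.pderiv ℝ 0 F +
        varY * MvPowerSeries.pderiv ℝ 1 F - varY * MvPowerSeries.pderiv ℝ 0 F := by ring
  rw [e, map_sub, map_add, map_add, coeff_pderiv_zero]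
  have h0 := coeff_X_mul_pderiv 0 (expo j l) F
  have h1 := coeff_X_mul_pderiv 1 (expo j l) F
  rw [← varX] at h0
  rw [← varY] at h1
  rw [h0, h1, expo_zero, expo_one]
  ring

/-! ### The functional equation of the Stirling series -/

theorem signedStirlingFirst_succ_succ (n k : ℕ) :
    signedStirlingFirst (n + 1) (k + 1) =
      signedStirlingFirst n k - n * signedStirlingFirst n (k + 1) := by
  simp only [signedStirlingFirst, Nat.stirlingFirst_succ_succ]
  push_cast
  ring

theorem coeff_stirlingSeries (j l : ℕ) :
    MvPowerSeries.coeff (expo j l) stirlingSeries =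
      if j = 0 then 0 else (signedStirlingFirst (j + l) (l + 1) : ℝ) / (Nat.factorial j : ℝ) := by
  change stirlingSeries (expo j l) = _
  simp [stirlingSeries]

/-- The exceptional case `j = 0` is superfluous because `S(l, l + 1) = 0`. -/
theorem coeff_stirlingSeries_eq (j l : ℕ) :
    MvPowerSeries.coeff (expo j l) stirlingSeries =
      (signedStirlingFirst (j + l) (l + 1) : ℝ) / (Nat.factorial j : ℝ) := by
  rw [coeff_stirlingSeries]
  split_ifs with h
  · subst h
    simp [signedStirlingFirst, Nat.stirlingFirst_eq_zero_of_lt]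
  · rfl

/-- In coefficients this is the recurrence `S(n + 1, k + 1) = S(n, k) - n S(n, k + 1)` at `n = j +
l`, `k = l`. The term `S(n, l)` cancels against `Y ∂σ/∂X`, except for `l = 0`, where `S(j, 0)`
survives and yields the constant `1`. -/
theorem stirlingSeries_transport :
    (1 + varX - varY) * MvPowerSeries.pderiv ℝ 0 stirlingSeries +
      varY * MvPowerSeries.pderiv ℝ 1 stirlingSeries = 1 := by
  classical
  refine series_ext fun j l => ?_
  rw [coeff_transport, coeff_stirlingSeries_eq, coeff_stirlingSeries_eq]
  have hj : ((j + 1 : ℕ) : ℝ) ≠ 0 := by positivity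
  have hf : (Nat.factorial j : ℝ) ≠ 0 := by positivity
  have h1 : (j + 1 : ℝ) * ((signedStirlingFirst (j + 1 + l) (l + 1) : ℝ) /
      (Nat.factorial (j + 1) : ℝ)) =
      ((signedStirlingFirst (j + l) l : ℝ) -
        (j + l) * (signedStirlingFirst (j + l) (l + 1) : ℝ)) / (Nat.factorial j : ℝ) := by
    rw [show j + 1 + l = j + l + 1 by ring, signedStirlingFirst_succ_succ, Nat.factorial_succ]
    push_cast at hj ⊢
    field_simp
  rw [h1]
  cases l with
  | zero =>
    rw [coeff_varY_mul_zero]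
    cases j with
    | zero =>
      rw [MvPowerSeries.coeff_one, if_pos (by simp [expo])]
      simp [signedStirlingFirst]
    | succ j =>
      rw [MvPowerSeries.coeff_one, if_neg (fun h => by simpa using DFunLike.congr_fun h 0)]
      simp only [signedStirlingFirst, Nat.stirlingFirst]
      push_cast
      ring
  | succ l =>
    rw [MvPowerSeries.coeff_one, if_neg (fun h => by simpa using DFunLike.congr_fun h 1),
      coeff_varY_mul_succ, coeff_pderiv_zero, coeff_stirlingSeries_eq, Nat.factorial_succ]
    rw [show j + 1 + l = j + (l + 1) by ring]
    push_cast at hj ⊢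
    field_simp
    ring

/-! ### The Burgers equation and the logarithmic derivative of `P` -/

theorem pderiv_comm (i j : Fin 2) (F : Series) :
    MvPowerSeries.pderiv ℝ i (MvPowerSeries.pderiv ℝ j F) =
      MvPowerSeries.pderiv ℝ j (MvPowerSeries.pderiv ℝ i F) := by
  ext m
  simp only [MvPowerSeries.coeff_pderiv, Finsupp.add_apply]
  rw [add_right_comm]
  by_cases h : i = j
  · subst h; ring
  · rw [Finsupp.single_eq_of_ne h, Finsupp.single_eq_of_ne (Ne.symm h)]
    push_cast
    ring

/-- A solution of the homogeneous transport equation is determined by its restriction to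
`X = 0`. -/
theorem eq_zero_of_transport {B : Series}
    (hB : (1 + varX - varY) * MvPowerSeries.pderiv ℝ 0 B + varY * MvPowerSeries.pderiv ℝ 1 B =
      -B)
    (h0 : ∀ l, MvPowerSeries.coeff (expo 0 l) B = 0) : B = 0 := by
  -- The coefficient of `X^j Y^l` in the equation expresses the one of `X^(j+1) Y^l` through those
  -- of `X^j Y^l` and `X^(j+1) Y^(l-1)`, whence a double induction.
  refine series_ext fun j => ?_
  induction j with
  | zero => simpa using h0
  | succ j ih =>
    intro l
    induction l with
    | zero =>
      have h := congrArg (MvPowerSeries.coeff (expo j 0)) hB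
      rw [coeff_transport, coeff_varY_mul_zero, map_neg, ih] at h
      simp only [map_zero] at h ⊢
      have : (j + 1 : ℝ) ≠ 0 := by positivity
      simpa [this] using h
    | succ l ihl =>
      have h := congrArg (MvPowerSeries.coeff (expo j (l + 1))) hB
      rw [coeff_transport, coeff_varY_mul_succ, coeff_pderiv_zero, ihl, map_neg, ih] at h
      simp only [map_zero] at h ⊢
      have : (j + 1 : ℝ) ≠ 0 := by positivity
      simpa [this] using h

theorem pderiv_zero_varX : MvPowerSeries.pderiv ℝ 0 varX = 1 := MvPowerSeries.pderiv_X_self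
theorem pderiv_one_varY : MvPowerSeries.pderiv ℝ 1 varY = 1 := MvPowerSeries.pderiv_X_self
theorem pderiv_zero_varY : MvPowerSeries.pderiv ℝ 0 varY = 0 :=
  MvPowerSeries.pderiv_X_of_ne (by decide)
theorem pderiv_one_varX : MvPowerSeries.pderiv ℝ 1 varX = 0 :=
  MvPowerSeries.pderiv_X_of_ne (by decide)

/-- Differentiating the transport equation in both variables shows that the defect `σ ∂σ/∂X - ∂σ/∂Y`
solves the homogeneous equation. It vanishes at `X = 0` because `X` divides `σ`, so it vanishes
identically. -/
theorem stirlingSeries_burgers :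
    MvPowerSeries.pderiv ℝ 1 stirlingSeries =
      stirlingSeries * MvPowerSeries.pderiv ℝ 0 stirlingSeries := by
  have hT := stirlingSeries_transport
  have hX := congrArg (MvPowerSeries.pderiv ℝ 0) hT
  have hY := congrArg (MvPowerSeries.pderiv ℝ 1) hT
  simp only [map_add, map_sub, Derivation.leibniz, smul_eq_mul, MvPowerSeries.pderiv_one,
    pderiv_zero_varX, pderiv_one_varY, pderiv_zero_varY, pderiv_one_varX,
    pderiv_comm 1 0] at hX hY
  refine (sub_eq_zero.mp (eq_zero_of_transport ?_ fun l => ?_)).symm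
  · simp only [map_sub, Derivation.leibniz, smul_eq_mul, pderiv_comm 1 0]
    linear_combination stirlingSeries * hX - hY + MvPowerSeries.pderiv ℝ 0 stirlingSeries * hT
  · obtain ⟨G, hG⟩ : varX ∣ stirlingSeries :=
      MvPowerSeries.X_dvd_iff.mpr fun m hm => by
        rw [eq_expo m, hm, coeff_stirlingSeries, if_pos rfl]
    have e : stirlingSeries * MvPowerSeries.pderiv ℝ 0 stirlingSeries -
        MvPowerSeries.pderiv ℝ 1 stirlingSeries =
        varX * (G * MvPowerSeries.pderiv ℝ 0 stirlingSeries - MvPowerSeries.pderiv ℝ 1 G) := by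
      nth_rewrite 3 [hG]
      nth_rewrite 1 [hG]
      rw [Derivation.leibniz, pderiv_one_varX, smul_zero, add_zero, smul_eq_mul]
      ring
    rw [e, coeff_varX_mul_zero]

/-- With the Burgers equation the transport equation becomes `(1 + X - Y + Y σ) ∂σ/∂X = 1`, which is
`P ∂σ/∂X = 1 + Y ∂σ/∂X`. -/
theorem PSeries_mul_pderiv_zero :
    PSeries * MvPowerSeries.pderiv ℝ 0 stirlingSeries = MvPowerSeries.pderiv ℝ 0 PSeries := by
  have hT := stirlingSeries_transport
  rw [stirlingSeries_burgers] at hT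
  simp only [PSeries, map_add, Derivation.leibniz, smul_eq_mul, MvPowerSeries.pderiv_one,
    pderiv_zero_varX, pderiv_zero_varY]
  linear_combination hT

theorem PSeries_mul_pderiv_one :
    PSeries * MvPowerSeries.pderiv ℝ 1 stirlingSeries = MvPowerSeries.pderiv ℝ 1 PSeries := by
  have hT := stirlingSeries_transport
  rw [stirlingSeries_burgers] at hT
  simp only [PSeries, map_add, Derivation.leibniz, smul_eq_mul, MvPowerSeries.pderiv_one,
    pderiv_one_varX, pderiv_one_varY, stirlingSeries_burgers]
  linear_combination stirlingSeries * hT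

/-- The transport of `Q`, which expresses that `u log u Q` is a primitive of `log u P`. -/
theorem QSeries_transport : (1 + varY) * QSeries + Delta QSeries = PSeries := by
  have hW := invOneAddDelta_spec (Delta PSeries - divY (Delta PSeries))
  have hd := varY_mul_divY_Delta PSeries
  unfold QSeries
  generalize invOneAddDelta (Delta PSeries - divY (Delta PSeries)) = W at hW ⊢
  simp only [Delta, map_add, map_sub, Derivation.leibniz, smul_eq_mul, MvPowerSeries.pderiv_one,
    pderiv_zero_varY, pderiv_one_varY] at hW hd ⊢
  linear_combination varY * hW - hd

/-! ### Series of order at least `n` and truncations -/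

/-- The ideal of the series all of whose monomials have total degree at least `n`. -/
def orderIdeal (n : ℕ) : Ideal Series where
  carrier := {F | ∀ m, m.degree < n → MvPowerSeries.coeff m F = 0}
  add_mem' := fun {F G} hF hG m hm => by rw [map_add, hF m hm, hG m hm, add_zero]
  zero_mem' := fun m _ => by rw [map_zero]
  smul_mem' := fun G F hF m hm => by
    refine MvPowerSeries.coeff_of_lt_order ?_
    have h1 : (n : ℕ∞) ≤ F.order := MvPowerSeries.nat_le_order hF
    have h2 : F.order ≤ (G • F).order :=
      le_trans le_add_self MvPowerSeries.le_order_mul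
    exact lt_of_lt_of_le (by exact_mod_cast hm) (h1.trans h2)

theorem mem_orderIdeal {n : ℕ} {F : Series} :
    F ∈ orderIdeal n ↔ ∀ m, m.degree < n → MvPowerSeries.coeff m F = 0 := Iff.rfl

theorem orderIdeal_anti {m n : ℕ} (h : m ≤ n) : orderIdeal n ≤ orderIdeal m :=
  fun _ hF d hd => hF d (hd.trans_le h)

theorem pderiv_mem_orderIdeal {n : ℕ} {F : Series} (i : Fin 2) (hF : F ∈ orderIdeal (n + 1)) :
    MvPowerSeries.pderiv ℝ i F ∈ orderIdeal n := fun m hm => by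
  rw [MvPowerSeries.coeff_pderiv, hF _ (by rw [map_add, Finsupp.degree_single]; omega), zero_mul]

theorem Delta_mem_orderIdeal {n : ℕ} {F : Series} (hF : F ∈ orderIdeal n) :
    Delta F ∈ orderIdeal (n + 1) := fun m hm =>
  MvPowerSeries.coeff_of_lt_order (lt_of_lt_of_le (by exact_mod_cast hm)
    (order_Delta (MvPowerSeries.nat_le_order hF)))

/-- The truncation of `F` to total degree at most `n`. -/
abbrev trunc (F : Series) (n : ℕ) : MvPolynomial (Fin 2) ℝ := MvPowerSeries.truncTotal (n + 1) F

theorem trunc_sub_mem (F : Series) (n : ℕ) : (trunc F n : Series) - F ∈ orderIdeal (n + 1) :=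
  fun m hm => by
    rw [map_sub, MvPolynomial.coeff_coe, MvPowerSeries.coeff_truncTotal _ hm, sub_self]

theorem coe_sub_polynomial (p q : MvPolynomial (Fin 2) ℝ) :
    ((p - q : MvPolynomial (Fin 2) ℝ) : Series) = (p : Series) - (q : Series) :=
  map_sub (MvPolynomial.coeToMvPowerSeries.ringHom (R := ℝ) (σ := Fin 2)) p q

/-- The value of a polynomial in `X` and `Y`. -/
abbrev evalXY (q : MvPolynomial (Fin 2) ℝ) (x y : ℝ) : ℝ := MvPolynomial.eval ![x, y] q

/-- This turns formal order into numerical size: for `r ≤ 1` each monomial of degree at least `n` is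
at most `r ^ n`, and `C` is the sum of the absolute values of the coefficients. -/
theorem exists_abs_evalXY_le {n : ℕ} {q : MvPolynomial (Fin 2) ℝ}
    (hq : (q : Series) ∈ orderIdeal n) :
    ∃ C : ℝ, 0 ≤ C ∧ ∀ r x y : ℝ, r ≤ 1 → |x| ≤ r → |y| ≤ r → |evalXY q x y| ≤ C * r ^ n := by
  refine ⟨∑ d ∈ q.support, |MvPolynomial.coeff d q|, by positivity, fun r x y hr hx hy => ?_⟩
  have hr0 : 0 ≤ r := (abs_nonneg x).trans hx
  rw [evalXY, MvPolynomial.eval_eq', Finset.sum_mul]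
  refine (Finset.abs_sum_le_sum_abs _ _).trans (Finset.sum_le_sum fun d hd => ?_)
  rw [abs_mul]
  refine mul_le_mul_of_nonneg_left ?_ (abs_nonneg _)
  have hdn : n ≤ d.degree := by
    by_contra! h
    have := hq d h
    rw [MvPolynomial.coeff_coe] at this
    exact (MvPolynomial.mem_support_iff.mp hd) this
  have hdeg : d.degree = d 0 + d 1 := by
    rw [Finsupp.degree_eq_sum, Fin.sum_univ_two]
  simp only [Fin.prod_univ_two, Matrix.cons_val_zero, Matrix.cons_val_one]
  rw [abs_mul, abs_pow, abs_pow]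
  calc |x| ^ d 0 * |y| ^ d 1 ≤ r ^ d 0 * r ^ d 1 := by gcongr
    _ = r ^ d.degree := by rw [hdeg, pow_add]
    _ ≤ r ^ n := pow_le_pow_of_le_one hr0 hr hdn

theorem hasDerivAt_evalXY (q : MvPolynomial (Fin 2) ℝ) {x y : ℝ → ℝ} {x' y' t : ℝ}
    (hx : HasDerivAt x x' t) (hy : HasDerivAt y y' t) :
    HasDerivAt (fun t => evalXY q (x t) (y t))
      (x' * evalXY (MvPolynomial.pderiv 0 q) (x t) (y t) +
        y' * evalXY (MvPolynomial.pderiv 1 q) (x t) (y t)) t := by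
  induction q using MvPolynomial.induction_on with
  | C a => simpa [evalXY] using hasDerivAt_const t a
  | add p q hp hq =>
    simp only [evalXY, map_add] at hp hq ⊢
    exact (hp.add hq).congr_deriv (by ring)
  | mul_X p i hp =>
    have hi : HasDerivAt (fun t => (![x t, y t] : Fin 2 → ℝ) i) (![x', y'] i) t := by
      fin_cases i
      · simpa using hx
      · simpa using hy
    simp only [evalXY, map_mul, MvPolynomial.eval_X, Derivation.leibniz, smul_eq_mul,
      map_add] at hp ⊢
    refine (hp.mul hi).congr_deriv ?_
    fin_cases i
    · simp [MvPolynomial.pderiv_X]; ring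
    · simp [MvPolynomial.pderiv_X]; ring

/-! ### The exponential of the truncated Stirling series -/

/-- The truncations inherit `P ∂σ = ∂P` up to order `n` only, since differentiating costs one
degree. -/
theorem pderiv_trunc_mem (n : ℕ) (i : Fin 2) :
    ((MvPolynomial.pderiv i (trunc PSeries n) - trunc PSeries n *
      MvPolynomial.pderiv i (trunc stirlingSeries n) : MvPolynomial (Fin 2) ℝ) : Series) ∈
      orderIdeal n := by
  have hA := trunc_sub_mem PSeries n
  have hB := trunc_sub_mem stirlingSeries n
  have hlog : PSeries * MvPowerSeries.pderiv ℝ i stirlingSeries =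
      MvPowerSeries.pderiv ℝ i PSeries := by
    fin_cases i
    · exact PSeries_mul_pderiv_zero
    · exact PSeries_mul_pderiv_one
  have h : ((MvPolynomial.pderiv i (trunc PSeries n) - trunc PSeries n *
      MvPolynomial.pderiv i (trunc stirlingSeries n) : MvPolynomial (Fin 2) ℝ) : Series) =
      MvPowerSeries.pderiv ℝ i ((trunc PSeries n : Series) - PSeries) -
      MvPowerSeries.pderiv ℝ i (trunc stirlingSeries n : Series) *
        ((trunc PSeries n : Series) - PSeries) -
      PSeries * MvPowerSeries.pderiv ℝ i ((trunc stirlingSeries n : Series) - stirlingSeries) := by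
    rw [coe_sub_polynomial, MvPolynomial.coe_mul, ← MvPowerSeries.pderiv_coe,
      ← MvPowerSeries.pderiv_coe, map_sub, map_sub]
    linear_combination -hlog
  rw [h]
  exact sub_mem (sub_mem (pderiv_mem_orderIdeal i hA)
    (Ideal.mul_mem_left _ _ (orderIdeal_anti n.le_succ hA)))
    (Ideal.mul_mem_left _ _ (pderiv_mem_orderIdeal i hB))

theorem constantCoeff_stirlingSeries : MvPowerSeries.coeff 0 stirlingSeries = 0 := by
  have h := coeff_stirlingSeries 0 0
  simpa [expo] using h

theorem constantCoeff_PSeries : MvPowerSeries.coeff 0 PSeries = 1 := by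
  simp [PSeries, varX, varY]

theorem evalXY_trunc_zero (F : Series) (n : ℕ) :
    evalXY (trunc F n) 0 0 = MvPowerSeries.coeff 0 F := by
  have h : (![0, 0] : Fin 2 → ℝ) = 0 := by ext i; fin_cases i <;> rfl
  rw [evalXY, h, MvPolynomial.eval_zero, MvPolynomial.constantCoeff_eq,
    MvPowerSeries.coeff_truncTotal _ (by simp)]

/-- The numerical form of `σ = log P`. Along the ray `t ↦ (t x, t y)` the derivative of `exp (-σ) P`
is `exp (-σ)` times `x` and `y` times the defects `∂P - P ∂σ`; the factors `x` and `y` recover the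
degree lost by differentiating. -/
theorem exists_abs_exp_trunc_le (n : ℕ) :
    ∃ C : ℝ, 0 ≤ C ∧ ∀ r x y : ℝ, r ≤ 1 → |x| ≤ r → |y| ≤ r →
      |Real.exp (-evalXY (trunc stirlingSeries n) x y) * evalXY (trunc PSeries n) x y - 1| ≤
        C * r ^ (n + 1) := by
  obtain ⟨C0, hC0, h0⟩ := exists_abs_evalXY_le (pderiv_trunc_mem n 0)
  obtain ⟨C1, hC1, h1⟩ := exists_abs_evalXY_le (pderiv_trunc_mem n 1)
  -- Order `0` imposes nothing, so this is a uniform bound for the truncated `σ`, used to control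
  -- `exp (-σ)`.
  obtain ⟨M, hM0, hM⟩ := exists_abs_evalXY_le (n := 0) (q := trunc stirlingSeries n)
    (mem_orderIdeal.mpr fun m hm => absurd hm (Nat.not_lt_zero _))
  refine ⟨Real.exp M * (C0 + C1), by positivity, fun r x y hr hx hy => ?_⟩
  have hr0 : 0 ≤ r := (abs_nonneg x).trans hx
  have hmem : ∀ {z t : ℝ}, |z| ≤ r → t ∈ Set.Icc (0 : ℝ) 1 → |t * z| ≤ r := by
    intro z t hz ht
    rw [abs_mul, abs_of_nonneg ht.1]
    exact (mul_le_of_le_one_left (abs_nonneg z) ht.2).trans hz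
  set f : ℝ → ℝ := fun t => Real.exp (-evalXY (trunc stirlingSeries n) (t * x) (t * y)) *
    evalXY (trunc PSeries n) (t * x) (t * y) with hf
  set f' : ℝ → ℝ := fun t => Real.exp (-evalXY (trunc stirlingSeries n) (t * x) (t * y)) *
    (x * evalXY (MvPolynomial.pderiv 0 (trunc PSeries n) - trunc PSeries n *
      MvPolynomial.pderiv 0 (trunc stirlingSeries n)) (t * x) (t * y) +
    y * evalXY (MvPolynomial.pderiv 1 (trunc PSeries n) - trunc PSeries n *
      MvPolynomial.pderiv 1 (trunc stirlingSeries n)) (t * x) (t * y)) with hf'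
  have hd : ∀ t : ℝ, HasDerivAt f (f' t) t := by
    intro t
    have hx' : HasDerivAt (fun t : ℝ => t * x) x t := by
      simpa using (hasDerivAt_id t).mul_const x
    have hy' : HasDerivAt (fun t : ℝ => t * y) y t := by
      simpa using (hasDerivAt_id t).mul_const y
    refine ((hasDerivAt_evalXY (trunc stirlingSeries n) hx' hy').neg.exp.mul
      (hasDerivAt_evalXY (trunc PSeries n) hx' hy')).congr_deriv ?_
    simp only [hf', evalXY, map_sub, map_mul]
    simp only [Pi.neg_apply]
    ring
  have hb : ∀ t ∈ Set.Ico (0 : ℝ) 1, ‖f' t‖ ≤ Real.exp M * (C0 + C1) * r ^ (n + 1) := by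
    intro t ht
    have ht' := Set.Ico_subset_Icc_self ht
    have e0 := h0 r _ _ hr (hmem hx ht') (hmem hy ht')
    have e1 := h1 r _ _ hr (hmem hx ht') (hmem hy ht')
    have eM := hM r _ _ hr (hmem hx ht') (hmem hy ht')
    rw [pow_zero, mul_one] at eM
    rw [Real.norm_eq_abs, hf', abs_mul, Real.abs_exp, mul_assoc]
    refine mul_le_mul (Real.exp_le_exp.mpr ((neg_le_abs _).trans eM)) ?_ (abs_nonneg _)
      (Real.exp_pos _).le
    refine (abs_add_le _ _).trans ?_
    rw [abs_mul, abs_mul, pow_succ]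
    have g0 := mul_le_mul hx e0 (abs_nonneg _) hr0
    have g1 := mul_le_mul hy e1 (abs_nonneg _) hr0
    calc _ ≤ r * (C0 * r ^ n) + r * (C1 * r ^ n) := add_le_add g0 g1
      _ = _ := by ring
  have key := norm_image_sub_le_of_norm_deriv_le_segment_01'
    (fun t _ => (hd t).hasDerivWithinAt) hb
  have z0 : f 0 = 1 := by
    simp only [hf, zero_mul]
    rw [evalXY_trunc_zero, evalXY_trunc_zero, constantCoeff_stirlingSeries, constantCoeff_PSeries]
    simp
  have z1 : f 1 = Real.exp (-evalXY (trunc stirlingSeries n) x y) *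
      evalXY (trunc PSeries n) x y := by
    simp only [hf, one_mul]
  rwa [z0, z1, Real.norm_eq_abs] at key

/-! ### The scales `𝒳` and `𝒴` -/

theorem eventually_calY_pos : ∀ᶠ u in atTop, 0 < calY u := by
  filter_upwards [eventually_gt_atTop 1] with u hu
  exact one_div_pos.mpr (Real.log_pos hu)

theorem eventually_calY_le_calX : ∀ᶠ u in atTop, calY u ≤ calX u := by
  filter_upwards [eventually_gt_atTop 1,
    (Real.tendsto_log_atTop.comp Real.tendsto_log_atTop).eventually_ge_atTop 1] with u hu h
  exact div_le_div_of_nonneg_right h (Real.log_pos hu).le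

/-- Since `𝒴 ≤ 𝒳` eventually, errors of order `n + 1` are measured by `𝒳 ^ (n + 1)`. They are
admissible because `(log log u) ^ (n + 1) = o(log u)`. -/
theorem calX_pow_isLittleO (n : ℕ) :
    (fun u => calX u ^ (n + 1)) =o[atTop] fun u => calY u ^ n := by
  have h : (fun u => Real.log (Real.log u) ^ (n + 1)) =o[atTop] Real.log :=
    (Real.isLittleO_pow_log_id_atTop (n := n + 1)).comp_tendsto Real.tendsto_log_atTop
  have h2 := h.mul_isBigO (Asymptotics.isBigO_refl (fun u => calY u ^ (n + 1)) atTop)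
  refine h2.congr' (Eventually.of_forall fun u => ?_) ?_
  · simp only [calX, calY, div_pow, one_pow]; ring
  · filter_upwards [eventually_gt_atTop 1] with u hu
    have h : Real.log u * (1 / Real.log u) = 1 := mul_one_div_cancel (Real.log_pos hu).ne'
    rw [calY, pow_succ', ← mul_assoc, h, one_mul]

theorem tendsto_calX : Tendsto calX atTop (𝓝 0) := by
  have h := calX_pow_isLittleO 0
  simpa using h

/-- It makes negligible both `δ ≤ 1 / η` in the equation for `s` and the error `O(1 / u)` in the
comparison of `log ρ` with the integral of `s`. -/
theorem eventually_inv_le_calX_pow (n : ℕ) : ∀ᶠ u in atTop, 1 / u ≤ calX u ^ n := by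
  filter_upwards [eventually_calY_pos, eventually_calY_le_calX, eventually_gt_atTop 1,
    (Real.isLittleO_pow_log_id_atTop (n := n)).bound one_pos] with u h0 h1 hu h2
  have hL := Real.log_pos hu
  rw [id, one_mul, Real.norm_eq_abs, Real.norm_eq_abs, abs_of_nonneg (by positivity),
    abs_of_pos (by linarith)] at h2
  calc 1 / u ≤ 1 / Real.log u ^ n := one_div_le_one_div_of_le (by positivity) h2
    _ = calY u ^ n := by rw [calY, div_pow, one_pow]
    _ ≤ calX u ^ n := by gcongr

theorem abs_log_sub_log_le {a b : ℝ} (ha : 1 / 2 ≤ a) (hb : 1 / 2 ≤ b) :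
    |Real.log a - Real.log b| ≤ 2 * |a - b| := by
  have key : ∀ {a b : ℝ}, 1 / 2 ≤ a → 1 / 2 ≤ b → Real.log a - Real.log b ≤ 2 * |a - b| := by
    intro a b ha hb
    have hb0 : 0 < b := by linarith
    have ha0 : 0 < a := by linarith
    rw [← Real.log_div ha0.ne' hb0.ne']
    refine (Real.log_le_sub_one_of_pos (by positivity)).trans ?_
    have h : a / b - 1 = (a - b) / b := by field_simp
    rw [h, div_le_iff₀ hb0]
    nlinarith [le_abs_self (a - b), abs_nonneg (a - b)]
  rw [abs_le]
  constructor
  · have := key hb ha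
    rw [abs_sub_comm] at this
    linarith
  · exact key ha hb

/-! ### The expansion of `s` -/

theorem exp_sFun {η : ℝ} (hη : 1 < η) : Real.exp (sFun η) = 1 + sFun η * η := by
  have h := phi_sFun hη
  have h0 := sFun_pos hη
  rw [phi, div_eq_iff h0.ne'] at h
  linarith

theorem one_le_sFun {η : ℝ} (hη : 2 ≤ η) : 1 ≤ sFun η := by
  have h1 : 1 < η := by linarith
  rw [← strictMonoOn_phi.le_iff_le (Set.mem_Ioi.mpr one_pos) (sFun_pos h1), phi_sFun h1]
  have := Real.exp_one_lt_d9
  simp only [phi]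
  linarith

/-- The approximate fixed point equation `s = log η + log s + δ`. -/
theorem sFun_eq {η : ℝ} (hη : 2 ≤ η) :
    ∃ δ, 0 ≤ δ ∧ δ ≤ 1 / η ∧ sFun η = Real.log η + Real.log (sFun η) + δ := by
  have hs := one_le_sFun hη
  have hη0 : 0 < η := by linarith
  have hs0 : 0 < sFun η := by linarith
  have h : sFun η = Real.log (1 + sFun η * η) := by
    rw [← exp_sFun (by linarith), Real.log_exp]
  have h2 : (1 + sFun η * η) = sFun η * η * (1 + 1 / (sFun η * η)) := by field_simp; ring
  have h3 : 0 < 1 / (sFun η * η) := by positivity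
  refine ⟨Real.log (1 + 1 / (sFun η * η)), Real.log_nonneg (by linarith), ?_, ?_⟩
  · have h4 := Real.log_le_sub_one_of_pos (by linarith : 0 < 1 + 1 / (sFun η * η))
    have h5 : 1 / (sFun η * η) ≤ 1 / η :=
      one_div_le_one_div_of_le hη0 (le_mul_of_one_le_left hη0.le hs)
    linarith
  · rw [h2, Real.log_mul (by positivity) (by positivity), Real.log_mul hs0.ne' hη0.ne'] at h
    linarith

theorem fixedPoint_trunc_mem (n : ℕ) :
    ((1 + MvPolynomial.X 0 + MvPolynomial.X 1 * trunc stirlingSeries n -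
      trunc PSeries n : MvPolynomial (Fin 2) ℝ) : Series) ∈
      orderIdeal (n + 1) := by
  have h : ((1 + MvPolynomial.X 0 + MvPolynomial.X 1 * trunc stirlingSeries n -
      trunc PSeries n : MvPolynomial (Fin 2) ℝ) : Series) =
      varY * ((trunc stirlingSeries n : Series) - stirlingSeries) -
        ((trunc PSeries n : Series) - PSeries) := by
    simp only [coe_sub_polynomial, MvPolynomial.coe_add, MvPolynomial.coe_mul, MvPolynomial.coe_X,
      MvPolynomial.coe_one]
    rw [← varX, ← varY]
    have : PSeries = 1 + varX + varY * stirlingSeries := rfl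
    linear_combination -this
  rw [h]
  exact sub_mem (Ideal.mul_mem_left _ _ (trunc_sub_mem _ n)) (trunc_sub_mem _ n)

/-- `s(η) / log η` is given by the series `P`, with explicit error terms. -/
theorem sFun_div_log_isBigO (n : ℕ) :
    (fun u => sFun u / Real.log u - truncEval PSeries n (calX u) (calY u)) =O[atTop]
      fun u => calX u ^ (n + 1) := by
  obtain ⟨C, hC0, hC⟩ := exists_abs_exp_trunc_le n
  obtain ⟨D, hD0, hD⟩ := exists_abs_evalXY_le (fixedPoint_trunc_mem n)
  have hP1 : ((trunc PSeries n - 1 : MvPolynomial (Fin 2) ℝ) : Series) ∈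
      orderIdeal 1 := fun m hm => by
    have hm0 : m = 0 := by
      rw [← Finsupp.degree_eq_zero_iff]; omega
    subst hm0
    rw [MvPolynomial.coeff_coe, MvPolynomial.coeff_sub,
      MvPowerSeries.coeff_truncTotal _ (by simp), constantCoeff_PSeries]
    simp
  obtain ⟨E, hE0, hE⟩ := exists_abs_evalXY_le hP1
  have hlim : ∀ c : ℝ, ∀ᶠ u in atTop, c * calX u ≤ 1 / 2 := fun c => by
    have h := tendsto_calX.const_mul c
    rw [mul_zero] at h
    exact h.eventually (ge_mem_nhds (by norm_num))
  -- The errors are `1` from `δ`, `2 * C` from `log z` and `D` from the truncated fixed point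
  -- equation; the factor `2` comes from absorbing half of `|p - q|`.
  refine Asymptotics.IsBigO.of_bound (2 * (1 + 2 * C + D)) ?_
  filter_upwards [eventually_calY_pos, eventually_calY_le_calX, eventually_ge_atTop 3,
    eventually_inv_le_calX_pow (n + 1), hlim 2, hlim C, hlim E, hlim 1]
    with u hY0 hYX hu hinv hX2 hXC hXE hX1
  have hL : 0 < Real.log u := Real.log_pos (by linarith)
  set x := calX u with hx
  set y := calY u with hy
  have hyL : y * Real.log u = 1 := by rw [hy, calY]; field_simp
  have hxL : x = y * Real.log (Real.log u) := by rw [hx, hy, calX, calY]; ring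
  have hx0 : 0 < x := hY0.trans_le hYX
  have hx1 : x ≤ 1 := by linarith
  have hxa : |x| ≤ x := (abs_of_pos hx0).le
  have hya : |y| ≤ x := (abs_of_pos hY0).le.trans hYX
  have bC := hC x x y hx1 hxa hya
  have bD := hD x x y hx1 hxa hya
  have bE := hE x x y hx1 hxa hya
  set q := evalXY (trunc PSeries n) x y with hq
  set σ := evalXY (trunc stirlingSeries n) x y with hσ
  set z := Real.exp (-σ) * q with hz
  have eD : evalXY (1 + MvPolynomial.X 0 + MvPolynomial.X 1 * trunc stirlingSeries n -
      trunc PSeries n) x y = 1 + x + y * σ - q := by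
    simp [evalXY, hσ, hq]
  have eE : evalXY (trunc PSeries n - 1) x y = q - 1 := by
    simp [evalXY, hq]
  rw [eD] at bD
  rw [eE, pow_one] at bE
  have hq2 : 1 / 2 ≤ q := by
    have := (abs_le.mp bE).1
    linarith
  have hxn : x ^ (n + 1) ≤ x := by
    rw [pow_succ]; exact mul_le_of_le_one_left hx0.le (pow_le_one₀ hx0.le hx1)
  have hz2 : 1 / 2 ≤ z := by
    have h1 := (abs_le.mp bC).1
    have h2 := mul_le_mul_of_nonneg_left hxn hC0
    linarith
  have hlogz : |Real.log z| ≤ 2 * (C * x ^ (n + 1)) := by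
    have h1 := abs_log_sub_log_le hz2 (by norm_num : (1 : ℝ) / 2 ≤ 1)
    rw [Real.log_one, sub_zero] at h1
    linarith
  have hlogq : Real.log z = -σ + Real.log q := by
    rw [hz, Real.log_mul (Real.exp_pos _).ne' (by linarith), Real.log_exp]
  obtain ⟨δ, hδ0, hδ1, hs⟩ := sFun_eq (by linarith : 2 ≤ u)
  have hs1 := one_le_sFun (by linarith : 2 ≤ u)
  -- Here `p` is the exact quotient and `q` the truncated series; `p ≥ 1` and `q, z ≥ 1 / 2`, where
  -- the logarithm is `2`-Lipschitz.
  set p := sFun u / Real.log u with hp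
  have hp1 : 1 ≤ p := by
    rw [hp, le_div_iff₀ hL]
    have := Real.log_nonneg hs1
    linarith
  have hlogp : Real.log p = Real.log (sFun u) - Real.log (Real.log u) := by
    rw [hp, Real.log_div (by linarith) hL.ne']
  have hpe : p = 1 + x + y * Real.log p + y * δ := by
    have hps : p = y * sFun u := by rw [hp, hy, calY]; ring
    linear_combination hps + y * hs + hyL - y * hlogp - hxL
  have hpq := abs_log_sub_log_le (by linarith : 1 / 2 ≤ p) hq2
  have hy4 : y ≤ 1 / 4 := by linarith
  have hdiff : p - q = y * (Real.log p - Real.log q) + (y * δ + (y * Real.log z +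
      (1 + x + y * σ - q))) := by
    linear_combination hpe - y * hlogq
  have habs : |p - q| ≤ y * (2 * |p - q|) + (1 / u + (2 * (C * x ^ (n + 1)) +
      D * x ^ (n + 1))) := by
    have hy1 : y ≤ 1 := by linarith
    have t1 : |y * (Real.log p - Real.log q)| ≤ y * (2 * |p - q|) := by
      rw [abs_mul, abs_of_pos hY0]; gcongr
    have t2 : |y * δ| ≤ 1 / u := by
      rw [abs_of_nonneg (by positivity)]
      exact (mul_le_of_le_one_left hδ0 hy1).trans hδ1
    have t3 : |y * Real.log z| ≤ 2 * (C * x ^ (n + 1)) := by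
      rw [abs_mul, abs_of_pos hY0]
      exact (mul_le_of_le_one_left (abs_nonneg _) hy1).trans hlogz
    calc |p - q| = _ := congrArg abs hdiff
      _ ≤ _ := (abs_add_le _ _).trans (add_le_add t1 ((abs_add_le _ _).trans
        (add_le_add t2 ((abs_add_le _ _).trans (add_le_add t3 bD)))))
  -- The contraction: `y ≤ 1 / 4` lets the logarithmic difference be absorbed on the left.
  have hfin : y * (2 * |p - q|) ≤ 1 / 2 * |p - q| := by nlinarith [abs_nonneg (p - q)]
  rw [Real.norm_eq_abs, Real.norm_eq_abs, abs_of_nonneg (by positivity : 0 ≤ x ^ (n + 1))]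
  change |p - q| ≤ _
  linarith

/-! ### Integration of asymptotic relations -/

/-- Once `|H'| ≤ (c / 2) w'`, both `±H + (c / 2) w` are nondecreasing. The initial values are
absorbed by another `(c / 2) w`, because `w` tends to infinity. -/
theorem isLittleO_of_deriv_isLittleO {H H' w w' : ℝ → ℝ}
    (hH : ∀ᶠ u in atTop, HasDerivAt H (H' u) u) (hw : ∀ᶠ u in atTop, HasDerivAt w (w' u) u)
    (hw0 : ∀ᶠ u in atTop, 0 ≤ w' u) (hwt : Tendsto w atTop atTop) (h : H' =o[atTop] w') :
    H =o[atTop] w := by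
  refine Asymptotics.IsLittleO.of_bound fun c hc => ?_
  obtain ⟨a, ha⟩ := eventually_atTop.mp
    (hH.and (hw.and (hw0.and (h.bound (half_pos hc)))))
  have hbound : ∀ x, a ≤ x → -(c / 2 * w' x) ≤ H' x ∧ H' x ≤ c / 2 * w' x := fun x hx => by
    obtain ⟨_, _, h0, hb⟩ := ha x hx
    rw [Real.norm_eq_abs, Real.norm_eq_abs, abs_of_nonneg h0] at hb
    exact abs_le.mp hb
  have mono : ∀ e : ℝ, (∀ x, a ≤ x → 0 ≤ H' x * e + c / 2 * w' x) →
      MonotoneOn (fun u => H u * e + c / 2 * w u) (Set.Ici a) := by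
    intro e he
    have hd : ∀ x ∈ Set.Ici a, HasDerivAt (fun u => H u * e + c / 2 * w u)
        (H' x * e + c / 2 * w' x) x := fun x hx =>
      ((ha x hx).1.mul_const e).add ((ha x hx).2.1.const_mul (c / 2))
    refine monotoneOn_of_hasDerivWithinAt_nonneg (convex_Ici a)
      (fun x hx => (hd x hx).continuousAt.continuousWithinAt)
      (fun x hx => (hd x (interior_subset hx)).hasDerivWithinAt)
      (fun x hx => he x (interior_subset hx))
  have m1 := mono 1 fun x hx => by have := (hbound x hx).1; linarith
  have m2 := mono (-1) fun x hx => by have := (hbound x hx).2; linarith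
  filter_upwards [eventually_ge_atTop a,
    hwt.eventually_ge_atTop (2 / c * (|H a| - c / 2 * w a)), hwt.eventually_ge_atTop 0]
    with u hu h1 h2
  have e1 := m1 Set.self_mem_Ici (Set.mem_Ici.mpr hu) hu
  have e2 := m2 Set.self_mem_Ici (Set.mem_Ici.mpr hu) hu
  simp only at e1 e2
  have h3 : |H a| - c / 2 * w a ≤ c / 2 * w u := by
    have := mul_le_mul_of_nonneg_left h1 (half_pos hc).le
    have e : c / 2 * (2 / c * (|H a| - c / 2 * w a)) = |H a| - c / 2 * w a := by field_simp
    linarith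
  rw [Real.norm_eq_abs, Real.norm_eq_abs, abs_of_nonneg h2, abs_le]
  have h4 := neg_abs_le (H a)
  have h5 := le_abs_self (H a)
  constructor <;> linarith

/-- The polynomial `(1 + Y + Δ) q`. -/
def transport (q : MvPolynomial (Fin 2) ℝ) : MvPolynomial (Fin 2) ℝ :=
  (1 + MvPolynomial.X 1) * q +
    (MvPolynomial.X 1 * (MvPolynomial.X 1 - MvPolynomial.X 0) * MvPolynomial.pderiv 0 q -
      MvPolynomial.X 1 ^ 2 * MvPolynomial.pderiv 1 q)

theorem coe_transport (q : MvPolynomial (Fin 2) ℝ) :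
    (transport q : Series) = (1 + varY) * (q : Series) + Delta (q : Series) := by
  simp only [transport, Delta, coe_sub_polynomial, MvPolynomial.coe_add, MvPolynomial.coe_mul,
    MvPolynomial.coe_X, MvPolynomial.coe_one, MvPolynomial.coe_pow, MvPowerSeries.pderiv_coe]
  rfl

/-- This is where `Δ` comes from: `u 𝒳' = 𝒴 (𝒴 - 𝒳)` and `u 𝒴' = -𝒴²`, while `(u log u)' = log u (1
+ 𝒴)`. -/
theorem hasDerivAt_mul_log_evalXY (q : MvPolynomial (Fin 2) ℝ) {u : ℝ} (hu : 1 < u) :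
    HasDerivAt (fun u => u * Real.log u * evalXY q (calX u) (calY u))
      (Real.log u * evalXY (transport q) (calX u) (calY u)) u := by
  have hu0 : u ≠ 0 := by linarith
  have hL : Real.log u ≠ 0 := (Real.log_pos hu).ne'
  have hl := Real.hasDerivAt_log hu0
  have hX : HasDerivAt calX ((calY u * (calY u - calX u)) / u) u := by
    refine ((hl.log hL).div hl hL).congr_deriv ?_
    simp only [calX, calY]
    field_simp
  have hY : HasDerivAt calY (-calY u ^ 2 / u) u := by
    refine ((hasDerivAt_const u (1 : ℝ)).div hl hL).congr_deriv ?_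
    simp only [calY]
    field_simp
    ring
  refine (((hasDerivAt_id u).mul hl).mul (hasDerivAt_evalXY q hX hY)).congr_deriv ?_
  have hLY : Real.log u * calY u = 1 := mul_one_div_cancel hL
  simp only [transport, evalXY, map_add, map_mul, map_sub, map_pow, MvPolynomial.eval_X, map_one,
    Matrix.cons_val_zero, Matrix.cons_val_one, id]
  simp only [Pi.mul_apply, id]
  field_simp
  linear_combination -(MvPolynomial.eval ![calX u, calY u]) q * hLY

/-! ### The integral of `s` -/

/-- A monotone function has no jump where its image fills a neighbourhood, and every `t > 0` is the
value of `s` at `phi t > 1`. -/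
theorem continuousAt_sFun {η : ℝ} (hη : 1 < η) : ContinuousAt sFun η := by
  refine continuousAt_of_monotoneOn_of_image_mem_nhds monotoneOn_sFun (Ioi_mem_nhds hη) ?_
  refine mem_of_superset (Ioi_mem_nhds (sFun_pos hη)) fun t ht => ?_
  have ht0 : (0 : ℝ) < t := ht
  have h1 : 1 < phi t := by
    rw [phi, lt_div_iff₀ ht0]
    linarith [Real.add_one_lt_exp ht0.ne']
  exact ⟨phi t, h1, (eq_sFun h1 ht0 rfl).symm⟩

theorem intervalIntegrable_sFun {a b : ℝ} (ha : 1 < a) (hb : 1 < b) :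
    IntervalIntegrable sFun MeasureTheory.volume a b :=
  ContinuousOn.intervalIntegrable fun _ hx =>
    (continuousAt_sFun (lt_of_lt_of_le (lt_min ha hb) hx.1)).continuousWithinAt

theorem hasDerivAt_integral_sFun {a u : ℝ} (ha : 1 < a) (hu : 1 < u) :
    HasDerivAt (fun u => ∫ η in a..u, sFun η) (sFun u) u :=
  intervalIntegral.integral_hasDerivAt_right (intervalIntegrable_sFun ha hu)
    (ContinuousOn.stronglyMeasurableAtFilter isOpen_Ioi
      (fun _ hx => (continuousAt_sFun hx).continuousWithinAt) u hu) (continuousAt_sFun hu)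

theorem transport_trunc_mem (n : ℕ) :
    ((trunc PSeries n - transport (trunc QSeries n) : MvPolynomial (Fin 2) ℝ) : Series) ∈
      orderIdeal (n + 1) := by
  have hP := trunc_sub_mem PSeries n
  have hQ := trunc_sub_mem QSeries n
  have hQ' := orderIdeal_anti (Nat.le_succ _) (Delta_mem_orderIdeal hQ)
  have h : ((trunc PSeries n - transport (trunc QSeries n) : MvPolynomial (Fin 2) ℝ) : Series) =
      ((trunc PSeries n : Series) - PSeries) -
        ((1 + varY) * ((trunc QSeries n : Series) - QSeries) +
          Delta ((trunc QSeries n : Series) - QSeries)) := by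
    rw [coe_sub_polynomial, coe_transport, ← QSeries_transport]
    have : Delta ((trunc QSeries n : Series)) = Delta ((trunc QSeries n : Series) - QSeries) +
        Delta QSeries := by
      rw [← Delta_add, sub_add_cancel]
    rw [this]
    ring
  rw [h]
  exact sub_mem hP (add_mem (Ideal.mul_mem_left _ _ hQ) hQ')

theorem evalXY_isBigO {n : ℕ} {q : MvPolynomial (Fin 2) ℝ} (hq : (q : Series) ∈ orderIdeal n) :
    (fun u => evalXY q (calX u) (calY u)) =O[atTop] fun u => calX u ^ n := by
  obtain ⟨C, -, hC⟩ := exists_abs_evalXY_le hq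
  refine Asymptotics.IsBigO.of_bound C ?_
  filter_upwards [eventually_calY_pos, eventually_calY_le_calX,
    tendsto_calX.eventually (ge_mem_nhds one_pos)] with u h0 h1 h2
  have hX : 0 < calX u := h0.trans_le h1
  rw [Real.norm_eq_abs, Real.norm_eq_abs, abs_of_nonneg (pow_nonneg hX.le n)]
  exact hC _ _ _ h2 (abs_of_pos hX).le ((abs_of_pos h0).le.trans h1)

theorem tendsto_mul_log_mul_calY_pow (n : ℕ) :
    Tendsto (fun u => u * Real.log u * calY u ^ n) atTop atTop := by
  refine tendsto_atTop_mono' _ ?_ Real.tendsto_log_atTop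
  filter_upwards [eventually_gt_atTop 1,
    (Real.isLittleO_pow_log_id_atTop (n := n)).bound one_pos] with u hu h
  have hL := Real.log_pos hu
  rw [id, one_mul, Real.norm_eq_abs, Real.norm_eq_abs, abs_of_nonneg (by positivity),
    abs_of_pos (by linarith)] at h
  rw [calY, div_pow, one_pow, mul_one_div, le_div_iff₀ (by positivity), mul_comm u]
  exact mul_le_mul_of_nonneg_left h hL.le

/-- `∫_a^u s` is `u log u` times a function associated to `Q`. -/
theorem integral_sFun_sub_isLittleO (n : ℕ) {a : ℝ} (ha : 1 < a) :
    (fun u => (∫ η in a..u, sFun η) -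
      u * Real.log u * truncEval QSeries n (calX u) (calY u)) =o[atTop]
      fun u => u * Real.log u * calY u ^ n := by
  have hderiv : (fun u => sFun u - Real.log u * evalXY (transport (trunc QSeries n))
      (calX u) (calY u)) =o[atTop] fun u => Real.log u * calY u ^ n := by
    have h := ((sFun_div_log_isBigO n).add (evalXY_isBigO (transport_trunc_mem n))).trans_isLittleO
      (calX_pow_isLittleO n)
    refine ((Asymptotics.isBigO_refl Real.log atTop).mul_isLittleO h).congr' ?_ EventuallyEq.rfl
    filter_upwards [eventually_gt_atTop 1] with u hu
    have hL := (Real.log_pos hu).ne'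
    simp only [truncEval, evalXY, map_sub]
    field_simp
    ring
  -- The derivative of the weight `u log u 𝒴 ^ n` comes from the same transport formula, applied to
  -- `Y ^ n`. It is comparable to `log u 𝒴 ^ n`, since the last factor is eventually at least `1 /
  -- 2`.
  have hw : ∀ u, 1 < u → Real.log u * evalXY (transport (MvPolynomial.X 1 ^ n))
      (calX u) (calY u) = Real.log u * calY u ^ n * (1 + (1 - n) * calY u) := by
    intro u hu
    simp only [transport, evalXY, map_add, map_mul, map_sub, map_pow, MvPolynomial.eval_X, map_one,
      Matrix.cons_val_zero, Matrix.cons_val_one, Derivation.leibniz_pow, MvPolynomial.pderiv_X]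
    cases n with
    | zero => simp
    | succ n => simp; ring
  have hYlim : ∀ᶠ u in atTop, 1 / 2 ≤ 1 + (1 - n) * calY u := by
    have h : Tendsto calY atTop (𝓝 0) :=
      (tendsto_const_nhds (x := (1 : ℝ))).div_atTop Real.tendsto_log_atTop
    have h2 := (h.const_mul (1 - n : ℝ)).const_add 1
    rw [mul_zero, add_zero] at h2
    exact h2.eventually (le_mem_nhds (by norm_num))
  refine isLittleO_of_deriv_isLittleO (H' := fun u => sFun u - Real.log u *
    evalXY (transport (trunc QSeries n)) (calX u) (calY u))
    (w' := fun u => Real.log u * evalXY (transport (MvPolynomial.X 1 ^ n)) (calX u) (calY u))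
    ?_ ?_ ?_ (tendsto_mul_log_mul_calY_pow n) ?_
  · filter_upwards [eventually_gt_atTop 1] with u hu
    exact (hasDerivAt_integral_sFun ha hu).sub (hasDerivAt_mul_log_evalXY _ hu)
  · filter_upwards [eventually_gt_atTop 1] with u hu
    have h := hasDerivAt_mul_log_evalXY (MvPolynomial.X 1 ^ n) hu
    simpa [evalXY] using h
  · filter_upwards [eventually_gt_atTop 1, hYlim, eventually_calY_pos] with u hu h1 h2
    rw [hw u hu]
    have := Real.log_pos hu
    have : 0 ≤ 1 + (1 - n) * calY u := by linarith
    positivity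
  · refine hderiv.trans_isBigO (Asymptotics.IsBigO.of_bound 2 ?_)
    filter_upwards [eventually_gt_atTop 1, hYlim, eventually_calY_pos] with u hu h1 h2
    rw [hw u hu, norm_mul _ (1 + (1 - n) * calY u), Real.norm_eq_abs (1 + (1 - n) * calY u),
      abs_of_nonneg (by linarith)]
    nlinarith [norm_nonneg (Real.log u * calY u ^ n)]

theorem isAssociatedSeries_QSeries :
    IsAssociatedSeries (fun u => 1 / (u * Real.log u) * ∫ η in (Real.exp 1)..u, sFun η)
      QSeries := by
  intro n
  have h := integral_sFun_sub_isLittleO n (Real.one_lt_exp_iff.mpr one_pos)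
  refine ((Asymptotics.isBigO_refl (fun u => 1 / (u * Real.log u)) atTop).mul_isLittleO h).congr'
    ?_ ?_
  all_goals
    filter_upwards [eventually_gt_atTop 1] with u hu
    have hL := (Real.log_pos hu).ne'
    have hu0 : u ≠ 0 := by linarith
    field_simp

/-! ### Comparison for the integral form of the delay equation -/

/-- At the first point `v` with `h v ≤ 0` the integral over `[v - 1, v]` is still positive, whereas
`v * h v ≤ 0`. Compactness provides the first point. -/
theorem pos_of_integral_le {h : ℝ → ℝ} {a : ℝ} (ha : 0 < a) (hc : ContinuousOn h (Set.Ici (a - 1)))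
    (h0 : ∀ u ∈ Set.Icc (a - 1) a, 0 < h u)
    (hi : ∀ u, a ≤ u → ∫ t in (u - 1)..u, h t ≤ u * h u) : ∀ u, a - 1 ≤ u → 0 < h u := by
  by_contra! hcon
  obtain ⟨b, hb, hhb⟩ := hcon
  set S := Set.Icc (a - 1) b ∩ h ⁻¹' Set.Iic 0 with hS
  have hcS : IsCompact S := by
    refine (isCompact_Icc).of_isClosed_subset ?_ Set.inter_subset_left
    exact (hc.mono Set.Icc_subset_Ici_self).preimage_isClosed_of_isClosed isClosed_Icc isClosed_Iic
  obtain ⟨v, hv, hmin⟩ := hcS.exists_isLeast ⟨b, ⟨hb, le_rfl⟩, hhb⟩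
  have hpos : ∀ t, a - 1 ≤ t → t < v → 0 < h t := fun t ht htv => by
    by_contra! hle
    exact absurd (hmin ⟨⟨ht, htv.le.trans hv.1.2⟩, hle⟩) (not_le.mpr htv)
  have hva : a < v := by
    by_contra! hle
    exact absurd (h0 v ⟨hv.1.1, hle⟩) (not_lt.mpr hv.2)
  have hsub : Set.Icc (v - 1) v ⊆ Set.Ici (a - 1) := fun t ht => by
    have := ht.1
    simp only [Set.mem_Ici]
    linarith
  have hint : IntervalIntegrable h MeasureTheory.volume (v - 1) v :=
    (hc.mono (by rwa [Set.uIcc_of_le (by linarith)])).intervalIntegrable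
  have hpi := intervalIntegral.intervalIntegral_pos_of_pos_on hint
    (fun t ht => hpos t (by linarith [ht.1]) ht.2) (by linarith)
  have h1 := hi v hva.le
  have h2 : v * h v ≤ 0 := mul_nonpos_of_nonneg_of_nonpos (by linarith) hv.2
  linarith

/-- By the delay equation the difference of the two sides has derivative zero for `u > 1`, and it
vanishes at `u = 1`. -/
theorem integral_rho {u : ℝ} (hu : 1 ≤ u) : ∫ t in (u - 1)..u, rho t = u * rho u := by
  have hii : ∀ a b, IntervalIntegrable rho MeasureTheory.volume a b :=
    fun a b => continuous_rho.intervalIntegrable a b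
  have hF : ∀ x, HasDerivAt (fun x => ∫ t in (0 : ℝ)..x, rho t) (rho x) x := fun x =>
    continuous_rho.integral_hasStrictDerivAt 0 x |>.hasDerivAt
  set D : ℝ → ℝ := fun x => (∫ t in (0 : ℝ)..x, rho t) - (∫ t in (0 : ℝ)..(x - 1), rho t) -
    x * rho x with hD
  have hdD : ∀ x, 1 < x → HasDerivAt D 0 x := fun x hx => by
    have h1 := (hF (x - 1)).comp x ((hasDerivAt_id x).sub_const 1)
    refine (((hF x).sub h1).sub ((hasDerivAt_id x).mul (hasDerivAt_rho hx))).congr_deriv ?_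
    have : x ≠ 0 := by linarith
    simp only [id]
    field_simp
    ring
  have hcD : Continuous D := by
    have hcF : Continuous fun x => ∫ t in (0 : ℝ)..x, rho t :=
      continuous_iff_continuousAt.mpr fun x => (hF x).continuousAt
    exact (hcF.sub (hcF.comp (continuous_id.sub continuous_const))).sub
      (continuous_id.mul continuous_rho)
  have hconst : D u = D 1 := by
    rcases hu.eq_or_lt with rfl | hu'
    · rfl
    obtain ⟨c, hc, hcd⟩ := exists_hasDerivAt_eq_slope D (fun _ => 0) hu' hcD.continuousOn
      fun x hx => hdD x hx.1
    have : u - 1 ≠ 0 := by linarith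
    field_simp at hcd
    linarith
  have h1 : ∫ t in (0 : ℝ)..1, rho t = 1 := by
    rw [intervalIntegral.integral_congr (g := fun _ => (1 : ℝ))]
    · simp
    · intro t ht
      rw [Set.uIcc_of_le zero_le_one] at ht
      exact rho_eq_one ht.2
  have hD1 : D 1 = 0 := by simp [hD, h1, rho_eq_one]
  rw [hD1] at hconst
  simp only [hD, intervalIntegral.integral_interval_sub_left (hii _ _) (hii _ _)] at hconst
  linarith

theorem rho_pos (u : ℝ) : 0 < rho u := by
  rcases le_or_gt u 1 with h | h
  · rw [rho_eq_one h]; exact one_pos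
  · refine pos_of_integral_le one_pos continuous_rho.continuousOn (fun v hv => ?_)
      (fun v hv => (integral_rho hv).le) u (by linarith)
    rw [rho_eq_one hv.2]; exact one_pos

/-! ### Bounds for `ρ` in terms of the integral of `s` -/

/-- The integral is `(e^s - 1) / s` at `s = s(u)`: the definition of `s` makes the exponential with
rate frozen at `u` balance the equation of `ρ` exactly. -/
theorem integral_exp_sub_mul_sFun {u : ℝ} (hu : 1 < u) :
    ∫ t in (u - 1)..u, Real.exp ((u - t) * sFun u) = u := by
  have h0 := (sFun_pos hu).ne'
  have hd : ∀ t ∈ Set.uIcc (u - 1) u,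
      HasDerivAt (fun t => -(Real.exp ((u - t) * sFun u) / sFun u))
      (Real.exp ((u - t) * sFun u)) t := fun t _ => by
    have h1 : HasDerivAt (fun t => (u - t) * sFun u) (-1 * sFun u) t :=
      ((hasDerivAt_id t).const_sub u).mul_const _
    refine (h1.exp.div_const (sFun u)).neg.congr_deriv ?_
    field_simp
  rw [intervalIntegral.integral_eq_sub_of_hasDerivAt hd
    (Continuous.intervalIntegrable (by fun_prop) _ _)]
  have h := phi_sFun hu
  rw [phi] at h
  simp only [sub_self, zero_mul, Real.exp_zero, sub_sub_cancel, one_mul]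
  linear_combination h

theorem integral_sFun_le {a b : ℝ} (ha : 1 < a) (hab : a ≤ b) :
    ∫ η in a..b, sFun η ≤ (b - a) * sFun b := by
  have h := intervalIntegral.integral_mono_on hab (intervalIntegrable_sFun ha (ha.trans_le hab))
    (intervalIntegrable_const (c := sFun b)) fun x hx =>
      monotoneOn_sFun (ha.trans_le hx.1) (ha.trans_le hab) hx.2
  simpa using h

theorem le_integral_sFun {a b : ℝ} (ha : 1 < a) (hab : a ≤ b) :
    (b - a) * sFun a ≤ ∫ η in a..b, sFun η := by
  have h := intervalIntegral.integral_mono_on hab (intervalIntegrable_const (c := sFun a))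
    (intervalIntegrable_sFun ha (ha.trans_le hab)) fun x hx =>
      monotoneOn_sFun ha (ha.trans_le hx.1) hx.1
  simpa using h

/-- The function `exp (-∫_e^u s)`. -/
def saddle (u : ℝ) : ℝ := Real.exp (-∫ η in (Real.exp 1)..u, sFun η)

theorem one_lt_exp_one : 1 < Real.exp 1 := Real.one_lt_exp_iff.mpr one_pos

theorem continuousOn_saddle : ContinuousOn saddle (Set.Ioi 1) := fun _ hu =>
  (hasDerivAt_integral_sFun one_lt_exp_one hu).continuousAt.neg.rexp.continuousWithinAt

theorem saddle_eq {u t : ℝ} (hu : 1 < u) (ht : 1 < t) :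
    saddle t = saddle u * Real.exp (∫ η in t..u, sFun η) := by
  rw [saddle, saddle, ← Real.exp_add, ← intervalIntegral.integral_add_adjacent_intervals
    (intervalIntegrable_sFun one_lt_exp_one ht) (intervalIntegrable_sFun ht hu)]
  congr 1
  ring

theorem intervalIntegrable_saddle {a b : ℝ} (ha : 1 < a) (hb : 1 < b) :
    IntervalIntegrable saddle MeasureTheory.volume a b :=
  (continuousOn_saddle.mono fun _ hx => (lt_min ha hb).trans_le hx.1).intervalIntegrable

/-- The supersolution: on `[u - 1, u]` the increasing rate `s` is at most `s(u)`. The condition `u >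
2` keeps the window inside `(1, ∞)`. -/
theorem integral_saddle_le {u : ℝ} (hu : 2 < u) :
    ∫ t in (u - 1)..u, saddle t ≤ u * saddle u := by
  have hu1 : 1 < u := by linarith
  calc ∫ t in (u - 1)..u, saddle t
      ≤ ∫ t in (u - 1)..u, saddle u * Real.exp ((u - t) * sFun u) := by
        refine intervalIntegral.integral_mono_on (by linarith)
          (intervalIntegrable_saddle (by linarith) hu1)
          (Continuous.intervalIntegrable (by fun_prop) _ _) fun t ht => ?_
        have ht1 : 1 < t := by linarith [ht.1]
        rw [saddle_eq hu1 ht1]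
        refine mul_le_mul_of_nonneg_left (Real.exp_le_exp.mpr (integral_sFun_le ht1 ht.2))
          (Real.exp_pos _).le
    _ = u * saddle u := by
        rw [intervalIntegral.integral_const_mul, integral_exp_sub_mul_sFun hu1, mul_comm]

/-- The subsolution: after the shift by one, the rate on `[t + 1, u + 1]` is at least `s(t + 1) ≥
s(u)`, because `t ≥ u - 1`. -/
theorem le_integral_saddle {u : ℝ} (hu : 2 < u) :
    u * saddle (u + 1) ≤ ∫ t in (u - 1)..u, saddle (t + 1) := by
  have hu1 : 1 < u := by linarith
  calc u * saddle (u + 1)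
      = ∫ t in (u - 1)..u, saddle (u + 1) * Real.exp ((u - t) * sFun u) := by
        rw [intervalIntegral.integral_const_mul, integral_exp_sub_mul_sFun hu1, mul_comm]
    _ ≤ ∫ t in (u - 1)..u, saddle (t + 1) := by
        refine intervalIntegral.integral_mono_on (by linarith)
          (Continuous.intervalIntegrable (by fun_prop) _ _) ?_ fun t ht => ?_
        · have h := (intervalIntegrable_saddle (a := u - 1 + 1) (b := u + 1)
            (by linarith) (by linarith)).comp_add_right 1
          simpa using h
        · have h1 := ht.1
          have h2 := ht.2
          have ht1 : 1 < t + 1 := by linarith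
          rw [saddle_eq (by linarith : 1 < u + 1) ht1]
          refine mul_le_mul_of_nonneg_left (Real.exp_le_exp.mpr ?_) (Real.exp_pos _).le
          refine le_trans ?_ (le_integral_sFun ht1 (by linarith))
          have h3 := monotoneOn_sFun (Set.mem_Ioi.mpr hu1) (Set.mem_Ioi.mpr ht1) (by linarith)
          rw [add_sub_add_right_eq_sub]
          exact mul_le_mul_of_nonneg_left h3 (by linarith)

/-- Two positive continuous functions on a compact interval are comparable. -/
theorem exists_mul_lt {f g : ℝ → ℝ} {a b : ℝ} (hab : a ≤ b) (hf : ContinuousOn f (Set.Icc a b))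
    (hg : ContinuousOn g (Set.Icc a b)) (hg0 : ∀ x ∈ Set.Icc a b, 0 < g x) :
    ∃ C, 0 < C ∧ ∀ x ∈ Set.Icc a b, f x < C * g x := by
  obtain ⟨x0, hx0, hmax⟩ := isCompact_Icc.exists_isMaxOn ⟨a, Set.left_mem_Icc.mpr hab⟩
    (hf.div hg fun x hx => (hg0 x hx).ne')
  refine ⟨|f x0 / g x0| + 1, by positivity, fun x hx => ?_⟩
  have h1 : f x / g x ≤ f x0 / g x0 := hmax hx
  have h2 := le_abs_self (f x0 / g x0)
  rw [← div_lt_iff₀ (hg0 x hx)]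
  linarith

theorem exists_rho_lt_saddle : ∃ C, 0 < C ∧ ∀ u, 2 ≤ u → rho u < C * saddle u := by
  have hc : ContinuousOn saddle (Set.Ici (3 - 1)) :=
    continuousOn_saddle.mono fun x hx => lt_of_lt_of_le (by norm_num) (Set.mem_Ici.mp hx)
  -- The constant secures the inequality on the initial window `[2, 3]`; comparison propagates it to
  -- all larger `u`.
  obtain ⟨C, hC, h⟩ := exists_mul_lt (a := 3 - 1) (b := 3) (by norm_num)
    continuous_rho.continuousOn (hc.mono Set.Icc_subset_Ici_self) fun _ _ => Real.exp_pos _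
  refine ⟨C, hC, fun u hu => sub_pos.mp (pos_of_integral_le (h := fun u => C * saddle u - rho u)
    (a := 3) (by norm_num) ((continuousOn_const.mul hc).sub continuous_rho.continuousOn)
    (fun v hv => sub_pos.mpr (h v hv)) (fun v hv => ?_) u (by linarith))⟩
  rw [intervalIntegral.integral_sub
    ((intervalIntegrable_saddle (by linarith) (by linarith)).const_mul C)
    (continuous_rho.intervalIntegrable _ _), intervalIntegral.integral_const_mul,
    integral_rho (by linarith)]
  have := mul_le_mul_of_nonneg_left (integral_saddle_le (by linarith : 2 < v)) hC.le
  linarith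

theorem exists_saddle_lt_rho : ∃ C, 0 < C ∧ ∀ u, 2 ≤ u → saddle (u + 1) < C * rho u := by
  have hc : ContinuousOn (fun u => saddle (u + 1)) (Set.Ici (3 - 1)) :=
    continuousOn_saddle.comp (continuous_add_const 1).continuousOn fun x hx => by
      have : (3 - 1 : ℝ) ≤ x := hx
      simp only [Set.mem_Ioi]
      linarith
  obtain ⟨C, hC, h⟩ := exists_mul_lt (a := 3 - 1) (b := 3) (by norm_num)
    (hc.mono Set.Icc_subset_Ici_self) continuous_rho.continuousOn fun _ _ => rho_pos _
  refine ⟨C, hC, fun u hu => sub_pos.mp (pos_of_integral_le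
    (h := fun u => C * rho u - saddle (u + 1))
    (a := 3) (by norm_num) ((continuous_rho.continuousOn.const_smul C).sub hc)
    (fun v hv => sub_pos.mpr (h v hv)) (fun v hv => ?_) u (by linarith))⟩
  have hi : IntervalIntegrable (fun t => saddle (t + 1)) MeasureTheory.volume (v - 1) v := by
    have := (intervalIntegrable_saddle (a := v - 1 + 1) (b := v + 1)
      (by linarith) (by linarith)).comp_add_right 1
    simpa using this
  rw [intervalIntegral.integral_sub ((continuous_rho.intervalIntegrable _ _).const_mul C) hi,
    intervalIntegral.integral_const_mul, integral_rho (by linarith)]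
  have := le_integral_saddle (by linarith : 2 < v)
  linarith

/-! ### The logarithm of `ρ` and its expansion -/

theorem log_saddle (u : ℝ) :
    Real.log (saddle u) = -∫ η in (Real.exp 1)..u, sFun η := Real.log_exp _

/-- Inserting `log s ≤ s / 2 - 1 + log 2` into `s = log η + log s + δ` leaves `s / 2 ≤ log η + log 2
- 1 / 2`. -/
theorem sFun_le_log {η : ℝ} (hη : 2 ≤ η) : sFun η ≤ 4 * Real.log η := by
  obtain ⟨δ, -, hδ, hs⟩ := sFun_eq hη
  have hs1 := one_le_sFun hη
  have h1 := Real.log_le_sub_one_of_pos (by linarith : 0 < sFun η / 2)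
  rw [Real.log_div (by linarith) two_ne_zero] at h1
  have h2 := Real.log_two_lt_d9
  have h3 := Real.log_two_gt_d9
  have h4 := Real.log_le_log two_pos hη
  have h5 := one_div_le_one_div_of_le two_pos hη
  linarith

/-- `log ρ(u) = -∫_e^u s + O(log u)`. -/
theorem log_rho_add_integral_isBigO :
    (fun u => Real.log (rho u) + ∫ η in (Real.exp 1)..u, sFun η) =O[atTop] Real.log := by
  obtain ⟨C, hC, h1⟩ := exists_rho_lt_saddle
  obtain ⟨D, hD, h2⟩ := exists_saddle_lt_rho
  refine Asymptotics.IsBigO.of_bound (|Real.log C| + |Real.log D| + 8) ?_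
  filter_upwards [eventually_ge_atTop 2, Real.tendsto_log_atTop.eventually_ge_atTop 1] with u hu hL
  have hs (v : ℝ) : 0 < saddle v := Real.exp_pos _
  have e1 := Real.log_le_log (rho_pos u) (h1 u hu).le
  have e2 := Real.log_le_log (hs _) (h2 u hu).le
  rw [Real.log_mul hC.ne' (hs u).ne', log_saddle] at e1
  rw [Real.log_mul hD.ne' (rho_pos u).ne', log_saddle,
    ← intervalIntegral.integral_add_adjacent_intervals
      (intervalIntegrable_sFun one_lt_exp_one (by linarith : 1 < u))
      (intervalIntegrable_sFun (by linarith) (by linarith : 1 < u + 1))] at e2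
  -- The shift in the lower bound costs `∫_u^{u+1} s ≤ s(u + 1) ≤ 4 log (u + 1) ≤ 8 log u`, whence
  -- the `8`.
  have e3 := integral_sFun_le (by linarith : 1 < u) (by linarith : u ≤ u + 1)
  have e4 := sFun_le_log (by linarith : 2 ≤ u + 1)
  have e5 : Real.log (u + 1) ≤ 2 * Real.log u := by
    have h := Real.log_le_log (by linarith : 0 < u + 1) (by nlinarith : u + 1 ≤ u ^ 2)
    rwa [Real.log_pow] at h
  rw [add_sub_cancel_left, one_mul] at e3
  have c1 := le_abs_self (Real.log C)
  have c2 := le_abs_self (Real.log D)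
  have c3 : |Real.log C| + |Real.log D| ≤ (|Real.log C| + |Real.log D|) * Real.log u :=
    le_mul_of_one_le_right (by positivity) hL
  have c4 := abs_nonneg (Real.log C)
  have c5 := abs_nonneg (Real.log D)
  rw [Real.norm_eq_abs, Real.norm_eq_abs, abs_of_nonneg (by linarith : 0 ≤ Real.log u), abs_le]
  constructor <;> linarith

theorem exists_rho_eq_exp (n : ℕ) : ∃ ε : ℝ → ℝ, ε =o[atTop] (fun u => calY u ^ n) ∧
    ∀ᶠ u in atTop, rho u = Real.exp (-(u * Real.log u *
      (truncEval QSeries n (calX u) (calY u) + ε u))) := by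
  -- As `ρ` is positive, `ε` is obtained by solving the desired identity; only its size remains to
  -- be bounded.
  refine ⟨fun u => -Real.log (rho u) / (u * Real.log u) -
    truncEval QSeries n (calX u) (calY u), ?_, ?_⟩
  · have h1 : (fun u => 1 / (u * Real.log u) *
        (Real.log (rho u) + ∫ η in (Real.exp 1)..u, sFun η)) =o[atTop] fun u => calY u ^ n := by
      refine (((Asymptotics.isBigO_refl (fun u => 1 / (u * Real.log u)) atTop).mul
        log_rho_add_integral_isBigO).trans ?_).trans_isLittleO (calX_pow_isLittleO n)
      refine Asymptotics.IsBigO.of_bound 1 ?_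
      filter_upwards [eventually_gt_atTop 1, eventually_inv_le_calX_pow (n + 1)] with u hu h
      have hL := (Real.log_pos hu).ne'
      have hu0 : u ≠ 0 := by linarith
      have e : 1 / (u * Real.log u) * Real.log u = 1 / u := by field_simp
      rw [e, one_mul, Real.norm_eq_abs, abs_of_pos (one_div_pos.mpr (by linarith))]
      exact h.trans (le_abs_self _)
    refine ((isAssociatedSeries_QSeries n).sub h1).congr' ?_ EventuallyEq.rfl
    filter_upwards [eventually_gt_atTop 1] with u hu
    have hL := (Real.log_pos hu).ne'
    have hu0 : u ≠ 0 := by linarith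
    field_simp
    ring
  · filter_upwards [eventually_gt_atTop 1] with u hu
    have hL := (Real.log_pos hu).ne'
    have hu0 : u ≠ 0 := by linarith
    rw [add_sub_cancel, mul_div_cancel₀ _ (mul_ne_zero hu0 hL), neg_neg, Real.exp_log (rho_pos u)]

end

end DickmanExpansion

theorem corollary3p6 :
    -- `Q` is the series associated to `u ↦ (1 / (u log u)) ∫_e^u s dη`
    DickmanExpansion.IsAssociatedSeries
      (fun u => 1 / (u * Real.log u) * ∫ η in (Real.exp 1)..u, DickmanExpansion.sFun η)
      DickmanExpansion.QSeries ∧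
    -- the expansion of the Dickman-de Bruijn function
    ∀ n : ℕ, ∃ ε : ℝ → ℝ,
      ε =o[Filter.atTop] (fun u => DickmanExpansion.calY u ^ n) ∧
      ∀ᶠ u in Filter.atTop,
        DickmanExpansion.rho u = Real.exp (-(u * Real.log u *
          (DickmanExpansion.truncEval DickmanExpansion.QSeries n
            (DickmanExpansion.calX u) (DickmanExpansion.calY u) + ε u))) := by
  exact ⟨DickmanExpansion.isAssociatedSeries_QSeries, DickmanExpansion.exists_rho_eq_exp⟩
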